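/- For non-negative integers $m_1,\dots,m_n$ ($n\ge 1$) with $\sum_i m_i=2g-2$, let $\mathcal H(m_1,\dots,m_n)$ be the stratum of Abelian differentials with labelled zeros $P_1,\dots,P_n$ of orders $m_1,\dots,m_n$; its complex dimension is $d=2g+n-1$. A square-tiled surface in $\mathcal H(m_1,\dots,m_n)$ is a connected translation surface in this stratum that is tiled with unit squares (with horizontal and vertical sides, glued side to side by translations) in such a way that $P_1,\dots,P_n$ are vertices of the tiling; such surfaces are considered up to isomorphism of translation surfaces respecting the labels. Let $\mathcal H_{\mathbb Z,1}(N)$ be the set of square-tiled surfaces in $\mathcal H=\mathcal H(m_1,\dots,m_n)$ that are tiled with at most $N$ squares and have exactly one maximal horizontal cylinder (i.e. the complement of the union of all horizontal leaves meeting some $P_i$ is connected). The absolute contribution of $1$-cylinder square-tiled surfaces to the Masur–Veech volume of $\mathcal H$ is $$c_1(\mathcal H)=2d\cdot\lim_{N\to+\infty}\frac{\operatorname{card}\mathcal H_{\mathbb Z,1}(N)}{N^d}.$$ For the principal stratum $\mathcal H(1^{2g-2})=\mathcal H(1,\dots,1)$, $g\ge 2$, and for the minimal stratum $\mathcal H(2g-2)$,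 $g\ge1$, this limit exists, and $$c_1(\mathcal H(1^{2g-2}))=\frac{\zeta(4g-3)}{4g-2}\cdot\frac{4}{2^{2g-2}},\qquad c_1(\mathcal H(2g-2))=\frac{\zeta(2g)}{2g}\cdot\frac{4}{2g-1}.$$ -/

import Mathlib

open Filter Topology

noncomputable section

/-- A square-tiled surface in the stratum of Abelian differentials with labelled zeros
`P i`, `i : ι`, of orders `m i`: a connected closed translation surface made of finitely many unit
squares, the right side of every square `x` being glued by a translation to the left side of the
square `right x`, and its top side to the bottom side of the square `up x`.

Turning once counterclockwise around the top right corner of `x`, one visits the squares `x`,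
`right x`, `up (right x)`, `right⁻¹ (up (right x))`, and comes down to
`up⁻¹ (right⁻¹ (up (right x)))`. So the vertices of the tiling are the cycles of this
permutation of the squares, and a cycle of length `k` is a vertex with cone angle `2πk`, that is, a
zero of order `k - 1` of the Abelian differential. -/
structure SquareTiledSurface {ι : Type} (m : ι → ℕ) where
  /-- the number of unit squares -/
  numSquares : ℕ
  numSquares_pos : 0 < numSquares
  /-- the square glued to the right side of a given square -/
  right : Equiv.Perm (Fin numSquares)
  /-- the square glued to the top side of a given square -/
  up : Equiv.Perm (Fin numSquares)
  /-- the surface is connected -/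
  connected : ∀ x y, ∃ p ∈ Subgroup.closure {right, up}, p x = y
  /-- the labelled points; they are vertices of the tiling -/
  point : ι → Quotient (Equiv.Perm.SameCycle.setoid (up⁻¹ * right⁻¹ * up * right))
  /-- points with different labels are different -/
  point_injective : Function.Injective point
  /-- the cone angle at the `i`-th labelled point is `2π (m i + 1)` -/
  card_point : ∀ i, Nat.card {x : Fin numSquares //
    (Quotient.mk _ x : Quotient
      (Equiv.Perm.SameCycle.setoid (up⁻¹ * right⁻¹ * up * right))) = point i} = m i + 1
  /-- at all other vertices the cone angle is `2π` -/
  card_of_notMem : ∀ P, P ∉ Set.range point → Nat.card {x : Fin numSquares //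
    (Quotient.mk _ x : Quotient
      (Equiv.Perm.SameCycle.setoid (up⁻¹ * right⁻¹ * up * right))) = P} = 1

namespace SquareTiledSurface

variable {ι : Type} {m : ι → ℕ}

/-- The vertices of the tiling. -/
def Vertex (S : SquareTiledSurface m) : Type :=
  Quotient (Equiv.Perm.SameCycle.setoid (S.up⁻¹ * S.right⁻¹ * S.up * S.right))

/-- The vertex at the top right corner of a square. -/
def corner (S : SquareTiledSurface m) (x : Fin S.numSquares) : S.Vertex :=
  Quotient.mk _ x

/-- The square `x` and all squares in its row lie directly below a closed horizontal leaf
that avoids the labelled points. -/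
def RegularTop (S : SquareTiledSurface m) (x : Fin S.numSquares) : Prop :=
  ∀ z, S.right.SameCycle x z → S.corner z ∉ Set.range S.point

/-- Two squares are adjacent inside one horizontal cylinder when they share a vertical side, or a
horizontal side that lies on a closed horizontal leaf avoiding the labelled points. -/
def CylinderAdj (S : SquareTiledSurface m) (x y : Fin S.numSquares) : Prop :=
  y = S.right x ∨ (y = S.up x ∧ S.RegularTop x)

/-- The number of maximal cylinders filled with closed horizontal leaves, i.e. the number of
connected components of the complement of all horizontal leaves that meet a labelled point. `Quot`
is the quotient by the equivalence relation generated by adjacency. -/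
def numCylinders (S : SquareTiledSurface m) : ℕ :=
  Nat.card (Quot S.CylinderAdj)

/-- Isomorphism of translation surfaces with labelled points. (It carries the tiling to the tiling,
since the corners of the squares are where the periods from a labelled point are in `ℤ + iℤ`.) -/
def Iso (S T : SquareTiledSurface m) : Prop :=
  ∃ e : Fin S.numSquares ≃ Fin T.numSquares,
    (∀ x, e (S.right x) = T.right (e x)) ∧ (∀ x, e (S.up x) = T.up (e x)) ∧
      ∀ i x, S.corner x = S.point i ↔ T.corner (e x) = T.point i

theorem iso_equivalence : Equivalence (Iso (m := m)) where
  refl S := ⟨Equiv.refl _, fun _ => rfl, fun _ => rfl, fun _ _ => Iff.rfl⟩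
  symm := by
    rintro S T ⟨e, hr, hu, hp⟩
    refine ⟨e.symm, fun x => ?_, fun x => ?_, fun i x => ?_⟩
    · rw [Equiv.symm_apply_eq, hr, e.apply_symm_apply]
    · rw [Equiv.symm_apply_eq, hu, e.apply_symm_apply]
    · rw [hp, e.apply_symm_apply]
  trans := by
    rintro S T U ⟨e, hr, hu, hp⟩ ⟨f, hr', hu', hp'⟩
    exact ⟨e.trans f, fun x => by simp [hr, hr'], fun x => by simp [hu, hu'],
      fun i x => by rw [hp, hp']; rfl⟩

instance setoid (m : ι → ℕ) : Setoid (SquareTiledSurface m) where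
  r := Iso
  iseqv := iso_equivalence

end SquareTiledSurface

/-- The set of (isomorphism classes of) square-tiled surfaces in the stratum that are tiled with at
most `N` unit squares and have exactly `k` maximal horizontal cylinders. -/
def squareTiledSurfaces {ι : Type} (m : ι → ℕ) (k N : ℕ) :
    Set (Quotient (SquareTiledSurface.setoid m)) :=
  Quotient.mk _ '' {S : SquareTiledSurface m | S.numSquares ≤ N ∧ S.numCylinders = k}

/-- The complex dimension `2g + n - 1` of the stratum with `n` labelled zeros of orders `m i`,
where `2g - 2 = ∑ i, m i`. -/
def stratumDim {ι : Type} [Fintype ι] (m : ι → ℕ) : ℕ :=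
  ∑ i, m i + Fintype.card ι + 1

/-- The absolute contribution `c_k` of `k`-cylinder square-tiled surfaces to the Masur-Veech volume
of the stratum exists and equals `c`. -/
def HasCylinderContribution {ι : Type} [Fintype ι] (m : ι → ℕ) (k : ℕ) (c : ℝ) : Prop :=
  Tendsto (fun N : ℕ => 2 * (stratumDim m : ℝ) *
    (((squareTiledSurfaces m k N).ncard : ℝ) / (N : ℝ) ^ stratumDim m)) atTop (𝓝 c)

end

/-!
The contribution of one-cylinder surfaces is computed for an arbitrary stratum with zeros of orders
`m i`, and the formula is then specialised.

**Surfaces as gluings.** A square-tiled surface with a single maximal horizontal cylinder is a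
cylinder of some height `h` and circumference `w`, whose top is glued to its bottom by a permutation
`ρ` of `ZMod w`. With `s x = x + 1`, turning around the corners of the top row is the commutator
`ρ⁻¹ s⁻¹ ρ s`, so its cycles have to be the labelled zeros, of lengths `m i + 1`, and fixed points.
The surface is determined by `h`, `w` and `ρ` with the labels of its zeros, up to rotations of the
cylinder (`ncard_squareTiledSurfaces_one`). To have a set with a group action, one first numbers the
`∑ i, (m i + 1)` corners at the zeros by an embedding `f` (`FramedGluing`); changing the numbering
and rotating the cylinder is an action of `ZMod w × ∏ i, ZMod (m i + 1)`, free up to lower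
order terms, so that Burnside's lemma counts its orbits (`card_gluingClass_bounds`).

**Framed gluings and pairs of full cycles.** Let `c` be the permutation with cycles of lengths
`m i + 1` on the image of `f`. The condition `ρ⁻¹ s⁻¹ ρ s = c` says that `ρ` conjugates `s c⁻¹` to
`s`, so there are `w` such `ρ` if `s c⁻¹` is a full cycle, and none otherwise. The number of `f`
for which this is a full cycle does not change when another full cycle replaces `s`. Averaging over
all of them leaves the number of ways to write `c` as a quotient of two full cycles
(`card_framedGluing`).

**Pairs of full cycles.** For a permutation `π` of `n` elements that number is
`(n - 1)! * ∫ x in 0..1, D π x`, with `D π x = det (x I + (1 - x) P_π)`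
(`fullCyclePairs_eq_integral`). By induction on `n`: removing from a full cycle an element that `π`
moves expresses the number for `π` as a sum of the numbers for permutations of the remaining
elements; on the other side the difference of the corresponding integrands is the derivative of
`-x (1 - x) D σ x`, where `σ` is `π` with that element removed, and this function vanishes at both
ends of the interval (`integral_det_permSegment_swap_mul_optionCongr`). Fixed points do not
contribute to `D`, and a cycle of length `l` contributes the factor `x ^ l - (x - 1) ^ l`.

**Summation.** The number of gluings is therefore asymptotic to `I / ∏ i, (m i + 1) * w ^ (d - 1)`,
where `d` is the dimension of the stratum and
`I = ∫ x in 0..1, ∏ i, (x ^ (m i + 1) - (x - 1) ^ (m i + 1))`. Summing over all `h` and `w` with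
`h * w ≤ N` gives `ζ d * I / ∏ i, (m i + 1) * N ^ d / d` (`tendsto_sum_hyperbola`), so the
contribution is `2 * ζ d * I / ∏ i, (m i + 1)` (`hasCylinderContribution_one`). In the minimal
stratum `I = 1 / g`, in the principal one `I = ∫ x in 0..1, (2 x - 1) ^ (2 g - 2) = 1 / (2 g - 1)`.
-/

open Equiv

/-! ### Pairs of full cycles -/

/-- A permutation with a single cycle, which contains all elements. Unlike for
`Equiv.Perm.IsCycle`, the identity of a one-element type qualifies. -/
def IsFullCycle {α : Type*} (σ : Perm α) : Prop := ∀ x y, σ.SameCycle x y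

/-- A permutation of a finite set is a full cycle if and only if it has no non-trivial invariant
subset. -/
theorem isFullCycle_iff_forall_set {α : Type*} [Finite α] {σ : Perm α} :
    IsFullCycle σ ↔ ∀ T : Set α, (∀ x ∈ T, σ x ∈ T) → T.Nonempty → T = Set.univ := by
  constructor
  · rintro h T hT ⟨x, hx⟩
    refine Set.eq_univ_of_forall fun y => ?_
    obtain ⟨n, -, rfl⟩ := (h x y).exists_pow_eq'
    clear h
    induction n with
    | zero => simpa
    | succ n ih => rw [pow_succ']; exact hT _ ih
  · intro h x y
    have := h {z | σ.SameCycle x z} (fun z hz => hz.trans ⟨1, rfl⟩) ⟨x, .refl _ _⟩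
    exact Set.eq_univ_iff_forall.1 this y

theorem IsFullCycle.permCongr {α β : Type*} (e : α ≃ β) {σ : Perm α} (h : IsFullCycle σ) :
    IsFullCycle (e.permCongr σ) := by
  intro x y
  obtain ⟨n, hn⟩ := h (e.symm x) (e.symm y)
  refine ⟨n, ?_⟩
  have : (e.permCongr σ) ^ n = e.permCongr (σ ^ n) := (map_zpow (e.permCongrHom) σ n).symm
  rw [this]
  simp [hn]

theorem isFullCycle_permCongr {α β : Type*} (e : α ≃ β) {σ : Perm α} :
    IsFullCycle (e.permCongr σ) ↔ IsFullCycle σ := by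
  refine ⟨fun h => ?_, fun h => h.permCongr e⟩
  have := h.permCongr e.symm
  rwa [← Equiv.permCongr_symm, Equiv.symm_apply_apply] at this

theorem isFullCycle_conj {α : Type*} (γ : Perm α) {σ : Perm α} :
    IsFullCycle (γ * σ * γ⁻¹) ↔ IsFullCycle σ :=
  isFullCycle_permCongr γ

/-- Inserting a new element into a cycle does not change the property of being a full cycle. -/
theorem isFullCycle_swap_mul_optionCongr {α : Type*} [DecidableEq α] [Finite α] (σ : Perm α)
    (a : α) :
    IsFullCycle (swap none (some a) * optionCongr σ) ↔ IsFullCycle σ := by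
  have key : ∀ x, (swap none (some a) * optionCongr σ) (some x) =
      if σ x = a then none else some (σ x) := by
    intro x
    simp only [Perm.mul_apply, optionCongr_apply, Option.map_some]
    split_ifs with h
    · rw [h, swap_apply_right]
    · exact swap_apply_of_ne_of_ne (by simp) (by simpa using h)
  have key0 : (swap none (some a) * optionCongr σ) none = some a := by simp
  rw [isFullCycle_iff_forall_set, isFullCycle_iff_forall_set]
  constructor
  · intro h T hT hne
    have := h {y | (∃ x ∈ T, y = some x) ∨ (y = none ∧ a ∈ T)} ?_ ?_
    · refine Set.eq_univ_of_forall fun x => ?_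
      have hx : some x ∈ (Set.univ : Set (Option α)) := trivial
      rw [← this] at hx
      simpa using hx
    · rintro y (⟨x, hx, rfl⟩ | ⟨rfl, ha⟩)
      · rw [key]
        have := hT x hx
        split_ifs with h'
        · exact Or.inr ⟨rfl, h' ▸ this⟩
        · exact Or.inl ⟨_, this, rfl⟩
      · rw [key0]; exact Or.inl ⟨_, ha, rfl⟩
    · obtain ⟨x, hx⟩ := hne
      exact ⟨some x, Or.inl ⟨x, hx, rfl⟩⟩
  · intro h T hT hne
    have hsome : (some ⁻¹' T).Nonempty := by
      obtain ⟨x | x, hx⟩ := hne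
      · exact ⟨a, by simpa [key0] using hT _ hx⟩
      · exact ⟨x, hx⟩
    have := h (some ⁻¹' T) ?_ hsome
    · refine Set.eq_univ_of_forall fun x => ?_
      have hall : ∀ x, some x ∈ T := fun x => by
        have : x ∈ some ⁻¹' T := this ▸ Set.mem_univ x
        exact this
      cases x with
      | none =>
        have := hT _ (hall (σ⁻¹ a))
        rw [key, if_pos (by simp)] at this
        exact this
      | some x => exact hall x
    · intro x hx
      have := hT _ hx
      rw [key] at this
      split_ifs at this with h'
      · have := hT _ this
        rw [key0] at this
        rw [h']; exact this
      · exact this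

theorem not_isFullCycle_optionCongr {α : Type*} [Nonempty α] (σ : Perm α) :
    ¬ IsFullCycle (optionCongr σ) := by
  intro h
  obtain ⟨a⟩ := ‹Nonempty α›
  obtain ⟨n, hn⟩ := h none (some a)
  rw [Perm.zpow_apply_eq_self_of_apply_eq_self (by simp)] at hn
  cases hn

theorem optionCongr_mul_swap_none {α : Type*} [DecidableEq α] (σ : Perm α) (a : α) :
    optionCongr σ * swap none (some a) = swap none (some (σ a)) * optionCongr σ := by
  rw [mul_swap_eq_swap_mul]; simp

theorem isFullCycle_optionCongr_mul_swap {α : Type*} [DecidableEq α] [Finite α] (σ : Perm α)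
    (a : α) :
    IsFullCycle (optionCongr σ * swap none (some a)) ↔ IsFullCycle σ := by
  rw [optionCongr_mul_swap_none, isFullCycle_swap_mul_optionCongr]

theorem optionCongr_mul_optionCongr {α : Type*} (σ τ : Perm α) :
    optionCongr σ * optionCongr τ = optionCongr (σ * τ) := by
  ext x : 1
  cases x <;> rfl

/-- The number of ways to write `π` as a quotient of two full cycles. -/
noncomputable def fullCyclePairs {α : Type*} (π : Perm α) : ℕ :=
  Nat.card {ω : Perm α // IsFullCycle ω ∧ IsFullCycle (ω * π)}

theorem fullCyclePairs_permCongr {α β : Type*} (e : α ≃ β) (π : Perm α) :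
    fullCyclePairs (e.permCongr π) = fullCyclePairs π := by
  refine (Nat.card_congr (e.permCongr.subtypeEquiv fun ω => ?_)).symm
  have : e.permCongr ω * e.permCongr π = e.permCongr (ω * π) :=
    (map_mul e.permCongrHom ω π).symm
  rw [this, isFullCycle_permCongr, isFullCycle_permCongr]

/-- Every full cycle of `Option α` arises from a unique full cycle of `α` by inserting `none` after
some element. -/
theorem fullCyclePairs_option {α : Type*} [DecidableEq α] [Fintype α] [Nonempty α]
    (π : Perm (Option α)) : fullCyclePairs π =
      ∑ c : α, Nat.card {ω : Perm α // IsFullCycle ω ∧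
        IsFullCycle (optionCongr ω * swap none (some c) * π)} := by
  rw [← Nat.card_sigma]
  symm
  refine Nat.card_eq_of_bijective (fun p : (Σ c : α, {ω : Perm α // IsFullCycle ω ∧
      IsFullCycle (optionCongr ω * swap none (some c) * π)}) =>
    (⟨optionCongr p.2.1 * swap none (some p.1),
      (isFullCycle_optionCongr_mul_swap _ _).2 p.2.2.1, p.2.2.2⟩ :
      {ω : Perm (Option α) // IsFullCycle ω ∧ IsFullCycle (ω * π)})) ⟨?_, ?_⟩
  · rintro ⟨c, ω, h⟩ ⟨c', ω', h'⟩ heq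
    simp only [Subtype.mk.injEq] at heq
    rw [optionCongr_mul_swap_none, optionCongr_mul_swap_none] at heq
    have := Perm.decomposeOption.symm.injective (a₁ := (some (ω c), ω)) (a₂ := (some (ω' c'), ω'))
      (by simpa using heq)
    simp only [Prod.mk.injEq, Option.some.injEq] at this
    obtain ⟨h1, rfl⟩ := this
    obtain rfl := ω.injective h1
    rfl
  · rintro ⟨ω, h, h'⟩
    obtain ⟨⟨i, σ⟩, hi⟩ := Perm.decomposeOption.symm.surjective ω
    rw [Perm.decomposeOption_symm_apply] at hi
    cases i with
    | none =>
      have hi : optionCongr σ = ω := by rw [← hi, swap_self]; rfl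
      exact absurd (hi ▸ h) (not_isFullCycle_optionCongr σ)
    | some a =>
      have hω : optionCongr σ * swap none (some (σ⁻¹ a)) = ω := by
        rw [optionCongr_mul_swap_none]; simpa using hi
      subst hω
      exact ⟨⟨σ⁻¹ a, σ, (isFullCycle_optionCongr_mul_swap _ _).1 h, h'⟩, rfl⟩

/-- A fixed point of `π` may be inserted anywhere into the first full cycle. -/
theorem fullCyclePairs_optionCongr {α : Type*} [DecidableEq α] [Fintype α] [Nonempty α]
    (π : Perm α) :
    fullCyclePairs (optionCongr π) = Fintype.card α * fullCyclePairs π := by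
  rw [fullCyclePairs_option]
  have : ∀ c : α, Nat.card {ω : Perm α // IsFullCycle ω ∧
        IsFullCycle (optionCongr ω * swap none (some c) * optionCongr π)} = fullCyclePairs π := by
    intro c
    refine Nat.card_congr (Equiv.subtypeEquivRight fun ω => ?_)
    rw [optionCongr_mul_swap_none, mul_assoc, optionCongr_mul_optionCongr,
      isFullCycle_swap_mul_optionCongr]
  simp [this]

/-- Removing from the first full cycle an element `none` that precedes `b` in a cycle of the
permutation, and summing over its predecessor `c` in the full cycle. -/
theorem fullCyclePairs_swap_mul_optionCongr {α : Type*} [DecidableEq α] [Fintype α] [Nonempty α]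
    (π : Perm α) (b : α) :
    fullCyclePairs (swap none (some b) * optionCongr π) =
      ∑ c ∈ Finset.univ.erase b, fullCyclePairs (swap b c * π) := by
  rw [fullCyclePairs_option, ← Finset.add_sum_erase _ _ (Finset.mem_univ b)]
  -- For `c = b` the second permutation fixes `none`.
  have h0 : Nat.card {ω : Perm α // IsFullCycle ω ∧ IsFullCycle (optionCongr ω *
      swap none (some b) * (swap none (some b) * optionCongr π))} = 0 := by
    rw [Nat.card_eq_zero]
    left
    refine ⟨fun ⟨ω, _, h⟩ => ?_⟩
    rw [mul_assoc, swap_mul_self_mul, optionCongr_mul_optionCongr] at h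
    exact not_isFullCycle_optionCongr _ h
  rw [h0, zero_add]
  refine Finset.sum_congr rfl fun c hc => Nat.card_congr (Equiv.subtypeEquivRight fun ω => ?_)
  have hcb : c ≠ b := Finset.ne_of_mem_erase hc
  have h1 : swap none (some c) * swap none (some b) =
      swap none (some b) * optionCongr (swap b c) := by
    rw [optionCongr_swap]
    ext x : 1
    rcases x with _ | x
    · simp [Perm.mul_apply, swap_apply_def, hcb.symm]
    · simp only [Perm.mul_apply, swap_apply_def]
      split_ifs <;> simp_all
  rw [mul_assoc (optionCongr ω), ← mul_assoc (swap _ _) (swap _ _), h1, mul_assoc,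
    optionCongr_mul_optionCongr, ← mul_assoc, optionCongr_mul_swap_none, mul_assoc,
    optionCongr_mul_optionCongr, isFullCycle_swap_mul_optionCongr]

/-! ### The determinant of the segment from a permutation matrix to the identity -/

/-- The point `x I + (1 - x) P_π` on the line through the identity matrix and a permutation
matrix. -/
noncomputable def permSegment {α : Type*} [DecidableEq α] (π : Perm α) (x : ℝ) : Matrix α α ℝ :=
  x • 1 + (1 - x) • π.permMatrix ℝ

theorem permSegment_apply {α : Type*} [DecidableEq α] (π : Perm α) (x : ℝ) (i j : α) :
    permSegment π x i j = x * (if i = j then 1 else 0) + (1 - x) * (if π i = j then 1 else 0) := by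
  simp [permSegment, Matrix.one_apply, PEquiv.toMatrix_apply, eq_comm]

theorem permSegment_permCongr {α β : Type*} [DecidableEq α] [DecidableEq β] (e : α ≃ β)
    (π : Perm α) (x : ℝ) :
    permSegment (e.permCongr π) x = (permSegment π x).submatrix e.symm e.symm := by
  ext i j
  simp only [permSegment_apply, Matrix.submatrix_apply, permCongr_apply, e.symm.injective.eq_iff,
    ← Equiv.symm_apply_eq, Equiv.symm_symm]
  simp only [← Equiv.eq_symm_apply]

section Determinant

variable {α : Type*} [DecidableEq α] [Fintype α]

theorem det_permSegment_permCongr {β : Type*} [DecidableEq β] [Fintype β] (e : α ≃ β)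
    (π : Perm α) (x : ℝ) :
    (permSegment (e.permCongr π) x).det = (permSegment π x).det := by
  rw [permSegment_permCongr, Matrix.det_submatrix_equiv_self]

theorem cramer_col_self (A : Matrix α α ℝ) (i : α) :
    A.cramer (fun k => A k i) = Pi.single i A.det := by
  have := A.transpose.cramer_transpose_row_self i
  rwa [Matrix.transpose_transpose, Matrix.det_transpose] at this

/-- Moving a vector from one column of a matrix to another one. -/
theorem det_updateCol_updateCol (A : Matrix α α ℝ) {b c : α} (hbc : b ≠ c) (u : α → ℝ) :
    ((A.updateCol b (fun k => A k b + u k)).updateCol c (fun k => A k c - u k)).det =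
      A.det + A.cramer u b - A.cramer u c := by
  have h1 : (fun k => A k c - u k) = (fun k => A k c) + (-1 : ℝ) • u := by
    ext k; simp; ring
  have h2 : (fun k => A k b + u k) = (fun k => A k b) + u := rfl
  have self (i : α) : A.updateCol i (fun k => A k i) = A := by
    ext k l; by_cases h : l = i <;> simp [h]
  have comm (v v' : α → ℝ) : (A.updateCol b v).updateCol c v' =
      (A.updateCol c v').updateCol b v := by
    ext k l; by_cases h : l = b <;> by_cases h' : l = c <;> simp_all
  -- The determinant is bilinear in the two columns, and the term with `u` in both vanishes.
  have zero : ((A.updateCol b u).updateCol c u).det = 0 :=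
    Matrix.det_zero_of_column_eq hbc fun k => by simp [hbc]
  rw [h1, h2, Matrix.det_updateCol_add, Matrix.det_updateCol_smul, comm, comm,
    Matrix.det_updateCol_add, Matrix.det_updateCol_add, ← comm _ u, ← comm _ u, zero]
  simp only [Matrix.cramer_apply, self]
  ring

/-- The rows of `x I + (1 - x) P_π` sum to `1`, so those of its adjugate sum to the determinant. -/
theorem adjugate_mulVec_one_permSegment (π : Perm α) (x : ℝ) (i : α) :
    ∑ j, (permSegment π x).adjugate i j = (permSegment π x).det := by
  have h1 : (permSegment π x).mulVec 1 = 1 := by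
    rw [permSegment, Matrix.add_mulVec, Matrix.smul_mulVec, Matrix.smul_mulVec,
      Matrix.permMatrix_mulVec, Matrix.one_mulVec]
    ext; simp
  have h2 := congrArg ((permSegment π x).adjugate.mulVec) h1
  rw [Matrix.mulVec_mulVec, Matrix.adjugate_mul, Matrix.smul_mulVec, Matrix.one_mulVec] at h2
  simpa [Matrix.mulVec, dotProduct] using (congrFun h2 i).symm

theorem one_vecMul_adjugate_permSegment (π : Perm α) (x : ℝ) (j : α) :
    ∑ i, (permSegment π x).adjugate i j = (permSegment π x).det := by
  have h1 : Matrix.vecMul 1 (permSegment π x) = 1 := by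
    rw [permSegment, Matrix.vecMul_add, Matrix.vecMul_smul, Matrix.vecMul_smul,
      Matrix.vecMul_permMatrix, Matrix.vecMul_one]
    ext; simp
  have h2 := congrArg (fun v => Matrix.vecMul v (permSegment π x).adjugate) h1
  simp only [Matrix.vecMul_vecMul, Matrix.mul_adjugate, Matrix.vecMul_smul, Matrix.vecMul_one] at h2
  simpa [Matrix.vecMul, dotProduct] using (congrFun h2 j).symm

/-- Multiplying by a transposition exchanges two columns of `P_π` but not of `I`: after exchanging
two columns of `x I + (1 - x) P_π`, the diagonal entries `x` have to be moved back. -/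
theorem det_permSegment_swap_mul (π : Perm α) (x : ℝ) {b c : α} (hbc : b ≠ c) :
    (permSegment (swap b c * π) x).det = -(permSegment π x).det +
      x * ((permSegment π x).adjugate b b - (permSegment π x).adjugate b c
        - (permSegment π x).adjugate c b + (permSegment π x).adjugate c c) := by
  set M := permSegment π x with hM
  set u : α → ℝ := (fun k => M k c) - (fun k => M k b) + x • (Pi.single b 1 - Pi.single c 1)
  have h1 : permSegment (swap b c * π) x =
      (M.updateCol b (fun k => M k b + u k)).updateCol c (fun k => M k c - u k) := by
    ext i j
    have hsw : swap b c (π i) = j ↔ π i = swap b c j := by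
      rw [← Equiv.eq_symm_apply, symm_swap]
    by_cases h : j = c
    · subst h
      simp only [Matrix.updateCol_self, u, hM, permSegment_apply, Perm.mul_apply, hsw,
        Pi.single_apply, Pi.add_apply, Pi.sub_apply, Pi.smul_apply, smul_eq_mul, swap_apply_right]
      ring
    · by_cases h' : j = b
      · subst h'
        simp only [Matrix.updateCol_self, Matrix.updateCol_ne hbc, u, hM, permSegment_apply,
          Perm.mul_apply, hsw, Pi.single_apply, Pi.add_apply, Pi.sub_apply, Pi.smul_apply, smul_eq_mul,
          swap_apply_left]
        ring
      · simp [hM, permSegment_apply, hsw, h, h',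
          swap_apply_of_ne_of_ne h' h]
  have hcr (k l : α) : M.cramer (Pi.single k 1) l = M.adjugate l k := by
    rw [Matrix.cramer_eq_adjugate_mulVec]; simp
  rw [h1, det_updateCol_updateCol _ hbc]
  simp only [u, map_add, map_sub, map_smul, cramer_col_self, Pi.add_apply, Pi.sub_apply,
    Pi.smul_apply, hcr, smul_eq_mul, Pi.single_eq_same, Pi.single_eq_of_ne hbc,
    Pi.single_eq_of_ne hbc.symm]
  ring

theorem sum_det_permSegment_swap_mul (π : Perm α) (x : ℝ) (b : α) :
    ∑ c ∈ Finset.univ.erase b, (permSegment (swap b c * π) x).det =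
      -((Fintype.card α : ℝ) - 1 + 2 * x) * (permSegment π x).det +
      x * (permSegment π x).adjugate.trace +
      x * Fintype.card α * (permSegment π x).adjugate b b := by
  rw [Finset.sum_congr rfl fun c hc =>
    det_permSegment_swap_mul π x (Finset.ne_of_mem_erase hc).symm]
  rw [Finset.sum_erase_eq_sub (Finset.mem_univ b), Finset.sum_add_distrib, ← Finset.mul_sum,
    Finset.sum_add_distrib, Finset.sum_sub_distrib, Finset.sum_sub_distrib,
    adjugate_mulVec_one_permSegment, one_vecMul_adjugate_permSegment]
  simp only [Finset.sum_const, Finset.card_univ, nsmul_eq_mul, Matrix.trace, Matrix.diag]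
  ring

theorem permSegment_option_submatrix (π : Perm (Option α)) (x : ℝ) :
    (permSegment π x).det = (Matrix.fromBlocks
      (Matrix.of fun i j : α => permSegment π x (some i) (some j))
      (Matrix.of fun (i : α) (_ : Unit) => permSegment π x (some i) none)
      (Matrix.of fun (_ : Unit) (j : α) => permSegment π x none (some j))
      (Matrix.of fun (_ _ : Unit) => permSegment π x none none)).det := by
  rw [← Matrix.det_submatrix_equiv_self (Equiv.optionEquivSumPUnit α).symm]
  congr 1
  ext (i | i) (j | j) <;> rfl

theorem det_permSegment_optionCongr (π : Perm α) (x : ℝ) :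
    (permSegment (optionCongr π) x).det = (permSegment π x).det := by
  rw [permSegment_option_submatrix]
  have h : (Matrix.of fun (_ _ : Unit) => permSegment (optionCongr π) x none none) = 1 := by
    ext; simp [permSegment_apply]
  have h' : (Matrix.of fun (i : α) (_ : Unit) =>
      permSegment (optionCongr π) x (some i) none) = 0 := by
    ext; simp [permSegment_apply]
  rw [h, h', Matrix.det_fromBlocks_zero₁₂, Matrix.det_one, mul_one]
  congr 1
  ext i j
  simp [permSegment_apply]

/-- Expansion of the determinant at an element `none` inserted into a cycle of the permutation. -/
theorem det_permSegment_swap_mul_optionCongr (π : Perm α) (x : ℝ) (b : α) :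
    (permSegment (swap none (some b) * optionCongr π) x).det =
      x * (permSegment π x).adjugate b b - (1 - x) * (permSegment π x).det := by
  set M := permSegment π x with hM
  set A := permSegment (swap none (some b) * optionCongr π) x with hA
  have e1 (i : α) : (swap none (some b) * optionCongr π) (some i) =
      if π i = b then none else some (π i) := by
    simp only [Perm.mul_apply, optionCongr_apply, Option.map_some]
    split_ifs with h
    · rw [h, swap_apply_right]
    · exact swap_apply_of_ne_of_ne (by simp) (by simpa using h)
  have e2 : (swap none (some b) * optionCongr π) none = some b := by simp
  -- After adding the column of `b` to the new column, the corner entry becomes `1`.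
  rw [← Matrix.det_updateCol_add_self A (i := none) (j := some b) (by simp),
    ← Matrix.det_submatrix_equiv_self (Equiv.optionEquivSumPUnit α).symm]
  have h1 : (A.updateCol none fun k => A k none + A k (some b)).submatrix
      (Equiv.optionEquivSumPUnit α).symm (Equiv.optionEquivSumPUnit α).symm =
      Matrix.fromBlocks (M.updateCol b (x • Pi.single b 1))
        (Matrix.of fun i (_ : Unit) => M i b)
        (Matrix.of fun (_ : Unit) j => if j = b then 1 - x else 0) 1 := by
    ext (i | i) (j | j)
    · simp only [Matrix.submatrix_apply, optionEquivSumPUnit_symm_inl, Matrix.fromBlocks_apply₁₁,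
        Matrix.updateCol_apply, hA, hM, permSegment_apply, e1]
      by_cases h : j = b
      · subst h
        by_cases h' : π i = j <;> simp [h', Pi.single_apply]
      · by_cases h' : π i = b
        · simp [h', h, Ne.symm h]
        · simp [h', h]
    · simp only [Matrix.submatrix_apply, optionEquivSumPUnit_symm_inl, Matrix.fromBlocks_apply₁₂,
        optionEquivSumPUnit_symm_inr, Matrix.updateCol_apply, hA, hM, permSegment_apply, e1]
      by_cases h' : π i = b
      · simp [h']; ring
      · simp [h']
    · simp only [Matrix.submatrix_apply, optionEquivSumPUnit_symm_inl, Matrix.fromBlocks_apply₂₁,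
        optionEquivSumPUnit_symm_inr, Matrix.updateCol_apply, hA, permSegment_apply, e2]
      simp [eq_comm]
    · simp only [Matrix.submatrix_apply, Matrix.fromBlocks_apply₂₂,
        optionEquivSumPUnit_symm_inr, Matrix.updateCol_apply, hA, permSegment_apply, e2]
      simp
  have h2 : M.updateCol b (x • Pi.single b 1) -
      (Matrix.of fun i (_ : Unit) => M i b) *
      (Matrix.of fun (_ : Unit) j => if j = b then 1 - x else 0) =
      M.updateCol b (x • Pi.single b 1 + (-(1 - x)) • (fun k => M k b)) := by
    ext i j
    by_cases h : j = b
    · simp [Matrix.mul_apply, h]; ring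
    · simp [Matrix.mul_apply, h]
  rw [h1, Matrix.det_fromBlocks_one₂₂, h2, ← Matrix.cramer_apply, map_add, map_smul, map_smul,
    cramer_col_self, Matrix.cramer_eq_adjugate_mulVec]
  simp
  ring

/-- Jacobi's formula along the line. -/
theorem hasDerivAt_det_permSegment (π : Perm α) (x : ℝ) :
    HasDerivAt (fun x => (permSegment π x).det)
      (((permSegment π x).adjugate * (1 - π.permMatrix ℝ)).trace) x := by
  have h0 (i j : α) : HasDerivAt (fun x => permSegment π x i j)
      ((1 - π.permMatrix ℝ : Matrix α α ℝ) i j) x := by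
    have := ((hasDerivAt_id x).mul_const ((1 : Matrix α α ℝ) i j)).add
      (((hasDerivAt_id x).const_sub 1).mul_const (π.permMatrix ℝ i j))
    refine (this.congr_deriv ?_).congr_of_eventuallyEq (.of_forall fun y => ?_)
    · rw [Matrix.sub_apply]; ring
    · simp [permSegment]
  have h1 : HasDerivAt (fun x => (permSegment π x).det)
      (∑ σ : Perm α, (Perm.sign σ : ℝ) * ∑ i, (∏ j ∈ Finset.univ.erase i,
        permSegment π x (σ j) j) • (1 - π.permMatrix ℝ : Matrix α α ℝ) (σ i) i) x := by
    simp only [Matrix.det_apply']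
    refine HasDerivAt.fun_sum fun σ _ => ?_
    exact (HasDerivAt.fun_finsetProd fun i _ => h0 (σ i) i).const_mul _
  convert h1 using 1
  simp only [Matrix.trace, Matrix.diag, Matrix.mul_apply]
  have h2 (i : α) : ∑ j, (permSegment π x).adjugate i j * (1 - π.permMatrix ℝ : Matrix α α ℝ) j i =
      ((permSegment π x).updateCol i fun k => (1 - π.permMatrix ℝ : Matrix α α ℝ) k i).det := by
    rw [← Matrix.cramer_apply, Matrix.cramer_eq_adjugate_mulVec]; rfl
  simp only [h2, Matrix.det_apply', Finset.mul_sum]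
  rw [Finset.sum_comm]
  refine Finset.sum_congr rfl fun σ _ => Finset.sum_congr rfl fun i _ => ?_
  rw [← Finset.prod_erase_mul _ _ (Finset.mem_univ i), Matrix.updateCol_self, smul_eq_mul]
  congr 2
  exact Finset.prod_congr rfl fun j hj => by
    rw [Matrix.updateCol_ne (Finset.ne_of_mem_erase hj)]

theorem trace_adjugate_permSegment (π : Perm α) (x : ℝ) :
    (permSegment π x).adjugate.trace =
      (1 - x) * ((permSegment π x).adjugate * (1 - π.permMatrix ℝ)).trace +
        Fintype.card α * (permSegment π x).det := by
  have h : (1 - x) • (1 - π.permMatrix ℝ) = 1 - permSegment π x := by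
    rw [permSegment, smul_sub, sub_smul, one_smul]; abel
  rw [← smul_eq_mul, ← Matrix.trace_smul, ← Matrix.mul_smul, h, Matrix.mul_sub, Matrix.mul_one,
    Matrix.adjugate_mul, Matrix.trace_sub, Matrix.trace_smul, Matrix.trace_one, smul_eq_mul]
  ring

theorem continuous_det_permSegment (π : Perm α) : Continuous fun x => (permSegment π x).det :=
  continuous_iff_continuousAt.2 fun x => (hasDerivAt_det_permSegment π x).continuousAt

/-- The recursion satisfied by `∫ x in 0..1, (permSegment π x).det` when an element is removed from
a cycle of the permutation: the two integrands differ by the derivative of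
`x (1 - x) (permSegment π x).det`. -/
theorem integral_det_permSegment_swap_mul_optionCongr (π : Perm α) (b : α) :
    Fintype.card α * ∫ x in (0 : ℝ)..1,
      (permSegment (swap none (some b) * optionCongr π) x).det =
    ∑ c ∈ Finset.univ.erase b, ∫ x in (0 : ℝ)..1, (permSegment (swap b c * π) x).det := by
  have hd (x : ℝ) : HasDerivAt (fun x => -(x * (1 - x) * (permSegment π x).det))
      (Fintype.card α * (permSegment (swap none (some b) * optionCongr π) x).det -
        ∑ c ∈ Finset.univ.erase b, (permSegment (swap b c * π) x).det) x := by
    have := ((((hasDerivAt_id x).mul ((hasDerivAt_id x).const_sub 1)).mul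
      (hasDerivAt_det_permSegment π x)).neg)
    refine this.congr_deriv ?_
    rw [sum_det_permSegment_swap_mul, det_permSegment_swap_mul_optionCongr,
      trace_adjugate_permSegment]
    simp
    ring
  have hc1 : Continuous fun x => (Fintype.card α : ℝ) *
      (permSegment (swap none (some b) * optionCongr π) x).det :=
    continuous_const.mul (continuous_det_permSegment _)
  have hc2 : Continuous fun x => ∑ c ∈ Finset.univ.erase b, (permSegment (swap b c * π) x).det :=
    continuous_finsetSum _ fun c _ => continuous_det_permSegment _
  have hc : Continuous fun x => Fintype.card α *
      (permSegment (swap none (some b) * optionCongr π) x).det -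
        ∑ c ∈ Finset.univ.erase b, (permSegment (swap b c * π) x).det := hc1.sub hc2
  have hint := intervalIntegral.integral_eq_sub_of_hasDerivAt (a := 0) (b := 1)
    (fun x _ => hd x) (hc.intervalIntegrable _ _)
  rw [intervalIntegral.integral_sub (hc1.intervalIntegrable _ _) (hc2.intervalIntegrable _ _),
    intervalIntegral.integral_const_mul, intervalIntegral.integral_finsetSum
      fun c _ => (continuous_det_permSegment _).intervalIntegrable _ _] at hint
  rw [sub_self, mul_zero, zero_mul, zero_mul, zero_mul, sub_self] at hint
  exact sub_eq_zero.1 hint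

end Determinant

/-- The number of factorisations of a permutation into two full cycles. -/
theorem fullCyclePairs_eq_integral {β : Type*} [DecidableEq β] [Fintype β] (π : Perm β) :
    (fullCyclePairs π : ℝ) = (Fintype.card β - 1).factorial *
      ∫ x in (0 : ℝ)..1, (permSegment π x).det := by
  -- It suffices to treat `Fin n`, and there one removes one element at a time.
  suffices H : ∀ (n : ℕ) (π : Perm (Fin n)), (fullCyclePairs π : ℝ) = (n - 1).factorial *
      ∫ x in (0 : ℝ)..1, (permSegment π x).det by
    have := H _ ((Fintype.equivFin β).permCongr π)
    simpa only [fullCyclePairs_permCongr, det_permSegment_permCongr] using this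
  intro n
  induction n with
  | zero =>
    intro π
    have : fullCyclePairs π = 1 := by
      rw [fullCyclePairs, Nat.card_eq_one_iff_unique]
      exact ⟨inferInstance, ⟨1, fun x => x.elim0, fun x => x.elim0⟩⟩
    simp [this]
  | succ n ih =>
    rcases Nat.eq_zero_or_pos n with rfl | hn
    · intro π
      have hs : Subsingleton (Fin (0 + 1)) := inferInstanceAs (Subsingleton (Fin 1))
      have : fullCyclePairs π = 1 := by
        rw [fullCyclePairs, Nat.card_eq_one_iff_unique]
        refine ⟨⟨fun x y => Subtype.ext (Subsingleton.elim _ _)⟩,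
          ⟨1, fun x y => ?_, fun x y => ?_⟩⟩ <;>
        exact Subsingleton.elim x y ▸ .refl _ _
      simp [this, permSegment_apply, Subsingleton.elim (π 0) 0]
    intro π
    have : Nonempty (Fin n) := ⟨⟨0, hn⟩⟩
    let e : Fin (n + 1) ≃ Option (Fin n) := finSuccEquiv n
    rw [← fullCyclePairs_permCongr e, ← funext fun x => det_permSegment_permCongr e π x]
    generalize e.permCongr π = τ
    have hn' : ((n + 1 - 1).factorial : ℝ) = n * (n - 1).factorial := by
      rw [Nat.add_sub_cancel, ← Nat.mul_factorial_pred hn.ne']; push_cast; rfl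
    obtain ⟨⟨i, σ⟩, rfl⟩ := Perm.decomposeOption.symm.surjective τ
    rw [Perm.decomposeOption_symm_apply]
    cases i with
    | none =>
      have : swap none none * optionCongr σ = optionCongr σ := by rw [swap_self]; rfl
      simp only [this, fullCyclePairs_optionCongr, det_permSegment_optionCongr, hn']
      rw [Nat.cast_mul, ih, Fintype.card_fin, mul_assoc]
    | some b =>
      simp only
      rw [fullCyclePairs_swap_mul_optionCongr, Nat.cast_sum, hn',
        Finset.sum_congr rfl fun c _ => ih (swap b c * σ), ← Finset.mul_sum,
        ← integral_det_permSegment_swap_mul_optionCongr, Fintype.card_fin]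
      ring

/-! ### Framed permutations of a cyclic group -/

/-- The elements of a full cycle, numbered in the order in which they are visited. -/
theorem IsFullCycle.exists_equiv_zmod {β : Type*} {σ : Perm β} (h : IsFullCycle σ)
    (x₀ : β) {n : ℕ} (hn : Nat.card β = n) :
    ∃ e : ZMod n ≃ β, e 0 = x₀ ∧ ∀ x, e (x + 1) = σ (e x) := by
  have horb : ∀ y, y ∈ MulAction.orbit (Subgroup.zpowers σ) x₀ := fun y => by
    obtain ⟨k, hk⟩ := h x₀ y
    exact ⟨⟨σ ^ k, k, rfl⟩, hk⟩
  let E : ZMod (Function.minimalPeriod (σ • ·) x₀) ≃ β :=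
    (MulAction.orbitZPowersEquiv σ x₀).symm.trans (Equiv.subtypeUnivEquiv horb)
  have hE (k : ℤ) : E k = (σ ^ k) x₀ := by
    simp only [E, Equiv.trans_apply]
    rw [MulAction.orbitZPowersEquiv_symm_apply']
    rfl
  have hcard : Function.minimalPeriod (σ • ·) x₀ = n := by
    rw [← hn, ← Nat.card_congr E, Nat.card_zmod]
  clear_value E
  revert E
  rw [hcard]
  intro E hE
  refine ⟨E, by simpa using hE 0, fun x => ?_⟩
  obtain ⟨k, rfl⟩ := ZMod.intCast_surjective x
  have := hE (k + 1)
  push_cast at this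
  rw [this, hE, add_comm, zpow_add, zpow_one, Perm.mul_apply]

section ViaEmbedding

variable {κ β γ : Type*}

theorem viaEmbedding_trans_equiv (π : Perm κ) (f : κ ↪ β) (e : β ≃ γ) :
    π.viaEmbedding (f.trans e.toEmbedding) = e.permCongr (π.viaEmbedding f) := by
  ext y
  rw [permCongr_apply]
  by_cases h : e.symm y ∈ Set.range f
  · obtain ⟨k, hk⟩ := h
    have : y = f.trans e.toEmbedding k := by simp [hk]
    rw [this, Perm.viaEmbedding_apply]
    simp [Perm.viaEmbedding_apply]
  · rw [Perm.viaEmbedding_apply_of_notMem _ _ _ h, apply_symm_apply,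
      Perm.viaEmbedding_apply_of_notMem]
    rintro ⟨k, rfl⟩
    simp at h

/-- `π.viaEmbedding f` is `π` on the image of `f` and fixes all other elements. -/
theorem eq_viaEmbedding_iff {π : Perm κ} {f : κ ↪ β} {σ : Perm β} :
    σ = π.viaEmbedding f ↔ (∀ k, σ (f k) = f (π k)) ∧ ∀ y ∉ Set.range f, σ y = y := by
  constructor
  · rintro rfl
    exact ⟨fun k => Perm.viaEmbedding_apply _ _ _, fun y => Perm.viaEmbedding_apply_of_notMem _ _ _⟩
  · rintro ⟨h1, h2⟩
    ext y
    by_cases h : y ∈ Set.range f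
    · obtain ⟨k, rfl⟩ := h
      rw [h1, Perm.viaEmbedding_apply]
    · rw [h2 y h, Perm.viaEmbedding_apply_of_notMem _ _ _ h]

theorem det_permSegment_sumCongr_one [DecidableEq κ] [Fintype κ] [DecidableEq γ] [Fintype γ]
    (π : Perm κ) (x : ℝ) :
    (permSegment (Perm.sumCongr π (1 : Perm γ)) x).det = (permSegment π x).det := by
  have : permSegment (Perm.sumCongr π (1 : Perm γ)) x =
      Matrix.fromBlocks (permSegment π x) 0 0 1 := by
    ext (i | i) (j | j) <;> simp [permSegment_apply, Matrix.one_apply]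
    split_ifs <;> simp
  rw [this, Matrix.det_fromBlocks_zero₁₂, Matrix.det_one, mul_one]

/-- Adding fixed points to a permutation does not change the determinant. -/
theorem det_permSegment_viaEmbedding [DecidableEq κ] [Fintype κ] [DecidableEq β] [Fintype β]
    (π : Perm κ) (f : κ ↪ β) (x : ℝ) :
    (permSegment (π.viaEmbedding f) x).det = (permSegment π x).det := by
  classical
  let e : κ ⊕ ((Set.range f)ᶜ : Set β) ≃ β :=
    ((Equiv.ofInjective f f.injective).sumCongr (Equiv.refl _)).trans (Equiv.Set.sumCompl _)
  have : π.viaEmbedding f = e.permCongr (Perm.sumCongr π 1) := by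
    symm
    rw [eq_viaEmbedding_iff]
    have he1 (k) : e (Sum.inl k) = f k := rfl
    have he2 (y) : e (Sum.inr y) = y := rfl
    constructor
    · intro k
      rw [permCongr_apply, ← he1, symm_apply_apply]
      rfl
    · intro y hy
      have hy' : e.symm y = Sum.inr ⟨y, hy⟩ := by rw [Equiv.symm_apply_eq, he2]
      rw [permCongr_apply, hy']
      rfl
  rw [this, det_permSegment_permCongr, det_permSegment_sumCongr_one]

end ViaEmbedding

/-- The cyclic permutation `x ↦ x + 1`. -/
def cyclicShift (w : ℕ) : Perm (ZMod w) := Equiv.addRight 1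

theorem cyclicShift_apply {w : ℕ} (x : ZMod w) : cyclicShift w x = x + 1 := rfl

theorem cyclicShift_zpow_apply {w : ℕ} (k : ℤ) (x : ZMod w) : (cyclicShift w ^ k) x = x + k := by
  simp [cyclicShift]

theorem isFullCycle_cyclicShift (w : ℕ) : IsFullCycle (cyclicShift w) := by
  intro x y
  obtain ⟨k, hk⟩ := ZMod.intCast_surjective (y - x)
  exact ⟨k, by rw [cyclicShift_zpow_apply, hk]; ring⟩

/-- The centraliser of the shift consists of the translations. -/
theorem apply_eq_add_of_comm_cyclicShift {w : ℕ} {ρ : ZMod w → ZMod w}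
    (h : ∀ x, ρ (x + 1) = ρ x + 1) (x : ZMod w) : ρ x = ρ 0 + x := by
  obtain ⟨k, rfl⟩ := ZMod.intCast_surjective x
  induction k using Int.induction_on with
  | zero => simp
  | succ i ih => push_cast at ih ⊢; rw [h, ih]; ring
  | pred i ih =>
    have := h ((-i - 1 : ℤ) : ZMod w)
    push_cast at ih this ⊢
    rw [sub_add_cancel, ih] at this
    linear_combination -this

/-- A full cycle on `ZMod w` is conjugate to the shift. -/
theorem IsFullCycle.exists_conj_cyclicShift {w : ℕ} [NeZero w] {t : Perm (ZMod w)}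
    (ht : IsFullCycle t) : ∃ γ : Perm (ZMod w), t = γ * cyclicShift w * γ⁻¹ := by
  obtain ⟨e, -, he⟩ := ht.exists_equiv_zmod 0 (Nat.card_zmod w)
  refine ⟨e, ?_⟩
  rw [eq_mul_inv_iff_mul_eq]
  ext x
  exact (he x).symm

/-- The solutions `ρ` form a coset of the centraliser of the shift, if there are any. -/
theorem card_conj_cyclicShift {w : ℕ} [NeZero w] (t : Perm (ZMod w)) [Decidable (IsFullCycle t)] :
    Nat.card {ρ : Perm (ZMod w) // ρ * t = cyclicShift w * ρ} =
      if IsFullCycle t then w else 0 := by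
  split_ifs with h
  · obtain ⟨γ, rfl⟩ := h.exists_conj_cyclicShift
    have e : ZMod w ≃ {ρ : Perm (ZMod w) //
        ρ * (γ * cyclicShift w * γ⁻¹) = cyclicShift w * ρ} :=
      { toFun := fun a => ⟨Equiv.addLeft a * γ⁻¹, by
          ext x; simp [cyclicShift, add_assoc]⟩
        invFun := fun ρ => ρ.1 (γ 0)
        left_inv := fun a => by simp
        right_inv := fun ⟨ρ, hρ⟩ => by
          have h1 : ∀ x, ρ (γ (x + 1)) = ρ (γ x) + 1 := fun x => by
            have := Equiv.congr_fun hρ (γ x)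
            simpa [cyclicShift] using this
          ext x
          have := apply_eq_add_of_comm_cyclicShift (ρ := fun x => ρ (γ x)) h1 (γ⁻¹ x)
          simpa using this.symm }
    rw [← Nat.card_congr e, Nat.card_zmod]
  · rw [Nat.card_eq_zero]
    left
    refine ⟨fun ⟨ρ, hρ⟩ => h ?_⟩
    have : t = ρ⁻¹ * cyclicShift w * ρ⁻¹⁻¹ := by rw [inv_inv, mul_assoc, ← hρ]; group
    rw [this, isFullCycle_conj]
    exact isFullCycle_cyclicShift w

/-- The permutations `ρ` of `ZMod w` whose commutator with the shift has the prescribed non-trivial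
part `π`, the elements moved by the commutator being labelled by `f`. Such a `ρ` is the gluing of
the top of a horizontal cylinder of circumference `w` to its bottom. -/
def FramedGluing {κ : Type*} (π : Perm κ) (w : ℕ) : Type _ :=
  {p : Perm (ZMod w) × (κ ↪ ZMod w) //
    p.1⁻¹ * (cyclicShift w)⁻¹ * p.1 * cyclicShift w = π.viaEmbedding p.2}

/-- A commutator with `s` is prescribed if and only if `r` conjugates a prescribed element
to `s`. -/
theorem commutator_eq_iff {G : Type*} [Group G] (r s c : G) :
    r⁻¹ * s⁻¹ * r * s = c ↔ r * (s * c⁻¹) = s * r := by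
  constructor
  · rintro rfl; group
  · intro h
    have : r * s = s * r * c := by rw [← h]; group
    rw [mul_assoc, this]; group

section Count

variable {κ : Type*} (π : Perm κ)

instance (w : ℕ) [NeZero w] : Finite (FramedGluing π w) :=
  Subtype.finite

/-- A gluing with a given frame is determined up to a rotation. -/
theorem card_gluing_le (w : ℕ) [NeZero w] (f : κ ↪ ZMod w) :
    Nat.card {ρ : Perm (ZMod w) //
      ρ⁻¹ * (cyclicShift w)⁻¹ * ρ * cyclicShift w = π.viaEmbedding f} ≤ w := by
  classical
  simp only [commutator_eq_iff, card_conj_cyclicShift]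
  split_ifs <;> simp

theorem card_framedGluing_eq_mul [Finite κ] (w : ℕ) [NeZero w] :
    Nat.card (FramedGluing π w) =
      w * Nat.card {f : κ ↪ ZMod w // IsFullCycle (cyclicShift w * (π.viaEmbedding f)⁻¹)} := by
  classical
  have := Fintype.ofFinite κ
  have e : FramedGluing π w ≃ Σ f : κ ↪ ZMod w, {ρ : Perm (ZMod w) //
      ρ⁻¹ * (cyclicShift w)⁻¹ * ρ * cyclicShift w = π.viaEmbedding f} :=
    { toFun := fun p => ⟨p.1.2, p.1.1, p.2⟩
      invFun := fun p => ⟨(p.2.1, p.1), p.2.2⟩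
      left_inv := fun _ => rfl
      right_inv := fun _ => rfl }
  rw [Nat.card_congr e, Nat.card_sigma]
  simp only [commutator_eq_iff, card_conj_cyclicShift]
  rw [Finset.sum_ite, Finset.sum_const_zero, add_zero, Finset.sum_const, smul_eq_mul, mul_comm,
    Nat.card_eq_fintype_card, Fintype.card_subtype]

/-- All full cycles are conjugate to the shift, and conjugation only permutes the frames. -/
theorem card_frame_eq_of_isFullCycle {w : ℕ} [NeZero w] {t : Perm (ZMod w)} (ht : IsFullCycle t) :
    Nat.card {f : κ ↪ ZMod w // IsFullCycle (t * (π.viaEmbedding f)⁻¹)} =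
    Nat.card {f : κ ↪ ZMod w // IsFullCycle (cyclicShift w * (π.viaEmbedding f)⁻¹)} := by
  obtain ⟨γ, rfl⟩ := ht.exists_conj_cyclicShift
  refine (Nat.card_congr ((Equiv.embeddingCongr (Equiv.refl κ) γ).subtypeEquiv fun f => ?_)).symm
  have h1 : Equiv.embeddingCongr (Equiv.refl κ) γ f = f.trans γ.toEmbedding := by ext; rfl
  have h2 : γ.permCongr (π.viaEmbedding f) = γ * π.viaEmbedding f * γ⁻¹ := rfl
  rw [h1, viaEmbedding_trans_equiv, h2, ← isFullCycle_conj γ]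
  congr! 1
  group

theorem card_isFullCycle (w : ℕ) [NeZero w] :
    Nat.card {t : Perm (ZMod w) // IsFullCycle t} = (w - 1).factorial := by
  -- The number of full cycles is the number of ways to write `1` as a quotient of two of them.
  have h := fullCyclePairs_eq_integral (1 : Perm (ZMod w))
  have h1 (x : ℝ) : permSegment (1 : Perm (ZMod w)) x = 1 := by
    simp [permSegment, ← add_smul]
  simp only [h1, Matrix.det_one, ZMod.card] at h
  simp only [intervalIntegral.integral_const, sub_zero, one_smul, mul_one, Nat.cast_inj] at h
  rw [← h]
  simp [fullCyclePairs]

theorem fullCyclePairs_inv {β : Type*} (σ : Perm β) : fullCyclePairs σ⁻¹ = fullCyclePairs σ := by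
  refine Nat.card_congr ((Equiv.mulRight σ⁻¹).subtypeEquiv fun ω => ?_)
  simp [and_comm]

/-- The number of framed gluings. Averaging over all full cycles in place of the shift reduces the
count to that of factorisations into two full cycles. -/
theorem card_framedGluing [Fintype κ] [DecidableEq κ] (w : ℕ) [NeZero w] :
    (Nat.card (FramedGluing π w) : ℝ) =
      w * (w.descFactorial (Fintype.card κ) * ∫ x in (0 : ℝ)..1, (permSegment π x).det) := by
  classical
  rw [card_framedGluing_eq_mul, Nat.cast_mul]
  congr 1
  -- Count the pairs of a full cycle `t` and an `f` such that `t c⁻¹` is a full cycle in two ways.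
  have h1 : Nat.card (Σ t : {t : Perm (ZMod w) // IsFullCycle t},
      {f : κ ↪ ZMod w // IsFullCycle (t.1 * (π.viaEmbedding f)⁻¹)}) =
      (w - 1).factorial *
        Nat.card {f : κ ↪ ZMod w // IsFullCycle (cyclicShift w * (π.viaEmbedding f)⁻¹)} := by
    rw [Nat.card_sigma, Finset.sum_congr rfl fun t _ => card_frame_eq_of_isFullCycle π t.2,
      Finset.sum_const, Finset.card_univ, smul_eq_mul, ← card_isFullCycle,
      Nat.card_eq_fintype_card (α := {t : Perm (ZMod w) // IsFullCycle t})]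
  have e : (Σ t : {t : Perm (ZMod w) // IsFullCycle t},
      {f : κ ↪ ZMod w // IsFullCycle (t.1 * (π.viaEmbedding f)⁻¹)}) ≃
      Σ f : κ ↪ ZMod w, {t : Perm (ZMod w) //
        IsFullCycle t ∧ IsFullCycle (t * (π.viaEmbedding f)⁻¹)} :=
    { toFun := fun p => ⟨p.2.1, p.1.1, p.1.2, p.2.2⟩
      invFun := fun p => ⟨⟨p.2.1, p.2.2.1⟩, p.1, p.2.2.2⟩
      left_inv := fun _ => rfl
      right_inv := fun _ => rfl }
  rw [Nat.card_congr e, Nat.card_sigma] at h1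
  have h2 (f : κ ↪ ZMod w) : ((Nat.card {t : Perm (ZMod w) //
        IsFullCycle t ∧ IsFullCycle (t * (π.viaEmbedding f)⁻¹)} : ℕ) : ℝ) =
      (w - 1).factorial * ∫ x in (0 : ℝ)..1, (permSegment π x).det := by
    have := fullCyclePairs_eq_integral (π.viaEmbedding f)
    rw [← fullCyclePairs_inv] at this
    simpa only [det_permSegment_viaEmbedding, ZMod.card, fullCyclePairs] using this
  have h3 := congrArg (Nat.cast (R := ℝ)) h1
  push_cast at h3
  rw [Finset.sum_congr rfl fun f _ => h2 f, Finset.sum_const, Finset.card_univ,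
    Fintype.card_embedding_eq, ZMod.card, nsmul_eq_mul] at h3
  have h4 : ((w - 1).factorial : ℝ) ≠ 0 := by positivity
  apply mul_left_cancel₀ h4
  rw [← h3]; ring

end Count

/-! ### Isomorphism classes of gluings -/

/-- The corners of a translation surface with zeros of orders `m i`, i.e. the vertices of the tiling
at labelled points seen from the different sheets: there are `m i + 1` of them at the `i`-th zero,
and they are numbered in cyclic order. -/
abbrev ConeCorner {ι : Type*} (m : ι → ℕ) : Type _ := (i : ι) × ZMod (m i + 1)

/-- Turning around each zero, by the multiple `b i` of the full angle at the `i`-th zero. -/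
def coneRotation {ι : Type*} (m : ι → ℕ) (b : ∀ i, ZMod (m i + 1)) : Perm (ConeCorner m) :=
  Perm.sigmaCongrRight fun i => Equiv.addRight (b i)

section Orbits

variable {ι : Type*} {m : ι → ℕ}

theorem coneRotation_apply (b : ∀ i, ZMod (m i + 1)) (k : ConeCorner m) :
    coneRotation m b k = ⟨k.1, k.2 + b k.1⟩ := rfl

theorem coneRotation_add (b b' : ∀ i, ZMod (m i + 1)) :
    coneRotation m (b + b') = coneRotation m b * coneRotation m b' := by
  ext k : 1
  simp only [coneRotation_apply, Perm.mul_apply, Pi.add_apply]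
  rw [add_comm (b _), add_assoc]

theorem coneRotation_comm (b b' : ∀ i, ZMod (m i + 1)) :
    coneRotation m b * coneRotation m b' = coneRotation m b' * coneRotation m b := by
  rw [← coneRotation_add, ← coneRotation_add, add_comm]

theorem coneRotation_zero : coneRotation m 0 = 1 := by
  ext k : 1; simp [coneRotation_apply]

/-- The gluing obtained by rotating the coordinate on the cylinder by `a` and changing the base
corners of the zeros by `b`. -/
def rotateGluing {w : ℕ} (a : ZMod w) (b : ∀ i, ZMod (m i + 1))
    (p : FramedGluing (coneRotation m 1) w) : FramedGluing (coneRotation m 1) w :=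
  ⟨(Equiv.addRight a * p.1.1 * (Equiv.addRight a)⁻¹,
    ((coneRotation m b).toEmbedding.trans p.1.2).trans (Equiv.addRight a).toEmbedding), by
    have h1 : (Equiv.addRight a).permCongr ((coneRotation m 1).viaEmbedding p.1.2) =
        Equiv.addRight a * (coneRotation m 1).viaEmbedding p.1.2 * (Equiv.addRight a)⁻¹ := rfl
    have h2 : Commute (cyclicShift w) (Equiv.addRight a) := by
      ext x; simp [cyclicShift, add_right_comm]
    have h3 : (coneRotation m 1).viaEmbedding ((coneRotation m b).toEmbedding.trans p.1.2) =
        (coneRotation m 1).viaEmbedding p.1.2 := by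
      symm
      rw [eq_viaEmbedding_iff]
      constructor
      · intro k
        have := Equiv.congr_fun (coneRotation_comm (m := m) 1 b) k
        simp only [Perm.mul_apply] at this
        simp [Perm.viaEmbedding_apply, this]
      · intro y hy
        refine Perm.viaEmbedding_apply_of_notMem _ _ _ ?_
        rintro ⟨k, rfl⟩
        exact hy ⟨(coneRotation m b).symm k, by simp⟩
    rw [viaEmbedding_trans_equiv, h3, h1, ← p.2]
    have h4 := h2.inv_right.eq
    generalize Equiv.addRight a = A at *
    simp only [mul_inv_rev, inv_inv, mul_assoc]
    rw [← h4, ← mul_assoc A⁻¹ (cyclicShift w)⁻¹, ← (h2.inv_left.inv_right).eq]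
    group⟩

theorem rotateGluing_val_fst {w : ℕ} (a : ZMod w) (b : ∀ i, ZMod (m i + 1))
    (p : FramedGluing (coneRotation m 1) w) (x : ZMod w) :
    (rotateGluing a b p).1.1 x = p.1.1 (x - a) + a := by
  simp [rotateGluing, sub_eq_add_neg]

theorem rotateGluing_val_snd {w : ℕ} (a : ZMod w) (b : ∀ i, ZMod (m i + 1))
    (p : FramedGluing (coneRotation m 1) w) (k : ConeCorner m) :
    (rotateGluing a b p).1.2 k = p.1.2 (coneRotation m b k) + a := rfl

theorem FramedGluing.ext' {κ : Type*} {π : Perm κ} {w : ℕ} {p q : FramedGluing π w}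
    (h1 : ∀ x, p.1.1 x = q.1.1 x) (h2 : ∀ k, p.1.2 k = q.1.2 k) : p = q :=
  Subtype.ext (Prod.ext (Equiv.ext h1) (Function.Embedding.ext h2))

instance (w : ℕ) : AddAction (ZMod w × ∀ i, ZMod (m i + 1))
    (FramedGluing (coneRotation m 1) w) where
  vadd g p := rotateGluing g.1 g.2 p
  zero_vadd p := by
    refine FramedGluing.ext' (fun x => ?_) fun k => ?_
    · exact (rotateGluing_val_fst 0 0 p x).trans (by simp)
    · exact (rotateGluing_val_snd 0 0 p k).trans (by simp [coneRotation_zero])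
  add_vadd g h p := by
    refine FramedGluing.ext' (fun x => ?_) fun k => ?_
    · refine (rotateGluing_val_fst _ _ p x).trans ?_
      refine Eq.trans ?_ (rotateGluing_val_fst g.1 g.2 (rotateGluing h.1 h.2 p) x).symm
      rw [rotateGluing_val_fst, Prod.fst_add, sub_sub, add_comm g.1, add_assoc, add_comm h.1]
    · refine (rotateGluing_val_snd _ _ p k).trans ?_
      refine Eq.trans ?_ (rotateGluing_val_snd g.1 g.2 (rotateGluing h.1 h.2 p) k).symm
      rw [rotateGluing_val_snd, Prod.fst_add, Prod.snd_add, add_comm g.2, coneRotation_add,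
        Perm.mul_apply, add_comm g.1, add_assoc]

theorem vadd_val_snd {w : ℕ} (g : ZMod w × ∀ i, ZMod (m i + 1))
    (p : FramedGluing (coneRotation m 1) w) (k : ConeCorner m) :
    (g +ᵥ p).1.2 k = p.1.2 (coneRotation m g.2 k) + g.1 := rfl

theorem vadd_val_fst {w : ℕ} (g : ZMod w × ∀ i, ZMod (m i + 1))
    (p : FramedGluing (coneRotation m 1) w) (x : ZMod w) :
    (g +ᵥ p).1.1 x = p.1.1 (x - g.1) + g.1 := rotateGluing_val_fst _ _ _ _

/-- Isomorphism classes of gluings of the top of a horizontal cylinder of circumference `w` to its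
bottom, in a way that produces zeros of orders `m i`. -/
abbrev GluingClass {ι : Type*} (m : ι → ℕ) (w : ℕ) : Type _ :=
  Quotient (AddAction.orbitRel (ZMod w × ∀ i, ZMod (m i + 1)) (FramedGluing (coneRotation m 1) w))

/-- One value of `f` is determined by the others. -/
theorem card_embedding_add_eq_le {κ : Type*} [Fintype κ] {w : ℕ} [NeZero w]
    {k₀ k₁ : κ} (hk : k₀ ≠ k₁) (a : ZMod w) :
    Nat.card {f : κ ↪ ZMod w // f k₁ + a = f k₀} ≤ w ^ (Fintype.card κ - 1) := by
  classical
  have hc : Nat.card ({k // k ≠ k₁} → ZMod w) = w ^ (Fintype.card κ - 1) := by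
    simp [Fintype.card_subtype_compl]
  rw [← hc]
  refine Nat.card_le_card_of_injective (fun f k => f.1 k.1) fun f f' h => ?_
  have h1 : ∀ k, k ≠ k₁ → f.1 k = f'.1 k := fun k hk => congrFun h ⟨k, hk⟩
  refine Subtype.ext (Function.Embedding.ext fun k => ?_)
  by_cases hkk : k = k₁
  · have := f.2.trans ((h1 k₀ hk).trans f'.2.symm)
    rw [hkk]; exact add_right_cancel this
  · exact h1 k hkk

variable [Fintype ι]

/-- An element `g ≠ 0` that fixes some gluing translates by a torsion element of bounded order and
rotates the frame at some zero. The frame then satisfies a linear relation, which leaves one degree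
of freedom less. -/
theorem card_fixedBy_le {w : ℕ} [NeZero w] (i₀ : ι) {g : ZMod w × ∀ i, ZMod (m i + 1)}
    (hg : g ≠ 0) :
    Nat.card (AddAction.fixedBy (FramedGluing (coneRotation m 1) w) g) ≤
      if (m i₀ + 1) • g.1 = 0 then w ^ Fintype.card (ConeCorner m) else 0 := by
  classical
  have hfix {p : FramedGluing (coneRotation m 1) w} (hp : g +ᵥ p = p) (k : ConeCorner m) :
      p.1.2 (coneRotation m g.2 k) + g.1 = p.1.2 k := by
    rw [← vadd_val_snd, hp]
  have hK : 0 < Fintype.card (ConeCorner m) := Fintype.card_pos_iff.2 ⟨⟨i₀, 0⟩⟩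
  rcases isEmpty_or_nonempty (AddAction.fixedBy (FramedGluing (coneRotation m 1) w) g) with h | h
  · simp
  obtain ⟨p, hp⟩ := h
  have htor : (m i₀ + 1) • g.1 = 0 := by
    have hiter (n : ℕ) : p.1.2 ⟨i₀, n • g.2 i₀⟩ + n • g.1 = p.1.2 ⟨i₀, 0⟩ := by
      induction n with
      | zero => simp
      | succ n ih =>
        have := hfix hp ⟨i₀, n • g.2 i₀⟩
        rw [coneRotation_apply] at this
        rw [succ_nsmul, succ_nsmul, ← ih, ← this]
        abel
    have := hiter (m i₀ + 1)
    have h0 : (m i₀ + 1) • g.2 i₀ = 0 := by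
      rw [nsmul_eq_mul, CharP.cast_eq_zero, zero_mul]
    rw [h0] at this
    simpa using this
  rw [if_pos htor]
  have hb : g.2 ≠ 0 := by
    intro hb
    have := hfix hp ⟨i₀, 0⟩
    rw [hb, coneRotation_zero, Perm.one_apply] at this
    exact hg (Prod.ext (by simpa using this) hb)
  obtain ⟨i, hi⟩ := Function.ne_iff.1 hb
  have hne : (⟨i, 0⟩ : ConeCorner m) ≠ ⟨i, g.2 i⟩ := by
    intro h
    simp only [Sigma.mk.injEq, heq_eq_eq, true_and] at h
    exact hi h.symm
  have hle : Nat.card (AddAction.fixedBy (FramedGluing (coneRotation m 1) w) g) ≤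
      Nat.card (Σ f : {f : ConeCorner m ↪ ZMod w // f ⟨i, g.2 i⟩ + g.1 = f ⟨i, 0⟩},
        {ρ : Perm (ZMod w) // ρ⁻¹ * (cyclicShift w)⁻¹ * ρ * cyclicShift w =
          (coneRotation m 1).viaEmbedding f.1}) := by
    refine Nat.card_le_card_of_injective (fun q => ⟨⟨q.1.1.2, ?_⟩, ⟨q.1.1.1, q.1.2⟩⟩) ?_
    · have := hfix q.2 ⟨i, 0⟩
      rwa [coneRotation_apply, zero_add] at this
    · rintro ⟨⟨⟨ρ, f⟩, h⟩, hq⟩ ⟨⟨⟨ρ', f'⟩, h'⟩, hq'⟩ heq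
      simp only [Sigma.mk.injEq, Subtype.mk.injEq] at heq
      obtain ⟨rfl, heq⟩ := heq
      simp only [heq_eq_eq, Subtype.mk.injEq] at heq
      subst heq
      rfl
  refine hle.trans ?_
  rw [Nat.card_sigma]
  refine (Finset.sum_le_sum fun f _ => card_gluing_le (coneRotation m 1) w f.1).trans ?_
  rw [Finset.sum_const, smul_eq_mul, Finset.card_univ, ← Nat.card_eq_fintype_card]
  refine (Nat.mul_le_mul_right _ (card_embedding_add_eq_le hne g.1)).trans ?_
  rw [← pow_succ, Nat.sub_add_cancel hK]

theorem card_nsmul_eq_zero_zmod_le (w : ℕ) [NeZero w] (n : ℕ) (hn : 0 < n) :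
    (Finset.univ.filter fun a : ZMod w => n • a = 0).card ≤ n :=
  IsAddCyclic.card_nsmul_eq_zero_le hn

/-- Burnside's lemma: up to lower order terms, the number of isomorphism classes is the number of
framed gluings divided by the number `w * ∏ i, (m i + 1)` of frames. -/
theorem card_gluingClass_bounds [DecidableEq ι] (i₀ : ι) (w : ℕ) [NeZero w] :
    (w.descFactorial (Fintype.card (ConeCorner m)) : ℝ) *
        (∫ x in (0 : ℝ)..1, (permSegment (coneRotation m 1) x).det) / ∏ i, (m i + 1 : ℝ) ≤
      Nat.card (GluingClass m w) ∧
    (Nat.card (GluingClass m w) : ℝ) ≤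
      (w.descFactorial (Fintype.card (ConeCorner m)) : ℝ) *
        (∫ x in (0 : ℝ)..1, (permSegment (coneRotation m 1) x).det) / ∏ i, (m i + 1 : ℝ) +
      (m i₀ + 1) * (w : ℝ) ^ (Fintype.card (ConeCorner m) - 1) := by
  classical
  set K := Fintype.card (ConeCorner m)
  set I := ∫ x in (0 : ℝ)..1, (permSegment (coneRotation m 1) x).det
  set Q : ℕ := ∏ i, (m i + 1) with hQ
  have hK : 0 < K := Fintype.card_pos_iff.2 ⟨⟨i₀, 0⟩⟩
  have hQ0 : 0 < Q := Finset.prod_pos fun i _ => Nat.succ_pos _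
  have hQ' : ∏ i, (m i + 1 : ℝ) = Q := by rw [hQ]; push_cast; rfl
  have hw : 0 < w := NeZero.pos w
  let G := ZMod w × ∀ i, ZMod (m i + 1)
  let X := FramedGluing (coneRotation m 1) w
  have := Fintype.ofFinite (GluingClass m w)
  have hfin (g : G) : Fintype (AddAction.fixedBy X g) := Fintype.ofFinite _
  have hburn := AddAction.sum_card_fixedBy_eq_card_orbits_mul_card_addGroup G X
  have hG : Fintype.card G = w * Q := by simp [G, hQ, ZMod.card]
  rw [hG, ← Finset.add_sum_erase _ _ (Finset.mem_univ (0 : G))] at hburn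
  have h0 : Fintype.card (AddAction.fixedBy X (0 : G)) = Nat.card X := by
    rw [← Nat.card_eq_fintype_card]
    refine Nat.card_congr (Equiv.subtypeUnivEquiv fun p => ?_)
    simp
  have hR : ∑ g ∈ Finset.univ.erase (0 : G), Fintype.card (AddAction.fixedBy X g) ≤
      (m i₀ + 1) * Q * w ^ K := by
    calc ∑ g ∈ Finset.univ.erase (0 : G), Fintype.card (AddAction.fixedBy X g)
        ≤ ∑ g ∈ Finset.univ.erase (0 : G), (if (m i₀ + 1) • g.1 = 0 then w ^ K else 0) := by
          refine Finset.sum_le_sum fun g hg => ?_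
          rw [← Nat.card_eq_fintype_card]
          exact card_fixedBy_le i₀ (Finset.ne_of_mem_erase hg)
      _ ≤ ∑ g : G, (if (m i₀ + 1) • g.1 = 0 then w ^ K else 0) :=
          Finset.sum_le_sum_of_subset (Finset.erase_subset _ _)
      _ = (Finset.univ.filter fun a : ZMod w => (m i₀ + 1) • a = 0).card * (Q * w ^ K) := by
          rw [Fintype.sum_prod_type, Finset.card_filter, Finset.sum_mul]
          refine Finset.sum_congr rfl fun a _ => ?_
          by_cases h : (m i₀ + 1) • a = 0
          · simp only [h, if_true, Finset.sum_const, Finset.card_univ, smul_eq_mul,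
              Fintype.card_pi, ZMod.card, one_mul, hQ]
          · simp only [h, if_false, Finset.sum_const_zero, zero_mul]
      _ ≤ (m i₀ + 1) * (Q * w ^ K) :=
          Nat.mul_le_mul_right _ (card_nsmul_eq_zero_zmod_le w _ (Nat.succ_pos _))
      _ = _ := by ring
  set R := ∑ g ∈ Finset.univ.erase (0 : G), Fintype.card (AddAction.fixedBy X g)
  have hburn' : (w : ℝ) * (w.descFactorial K * I) + R = Nat.card (GluingClass m w) * (w * Q) := by
    rw [h0] at hburn
    have := congrArg (Nat.cast (R := ℝ)) hburn
    push_cast at this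
    rw [card_framedGluing] at this
    rw [Nat.card_eq_fintype_card]
    exact this
  clear_value R
  have hRr : (R : ℝ) ≤ (m i₀ + 1) * Q * (w ^ (K - 1) * w) := by
    rw [← pow_succ, Nat.sub_add_cancel hK]
    exact_mod_cast hR
  have hw' : (0 : ℝ) < w := by exact_mod_cast hw
  have hQr : (0 : ℝ) < Q := by exact_mod_cast hQ0
  have hAeq : (Nat.card (GluingClass m w) : ℝ) = w.descFactorial K * I / Q + R / (w * Q) := by
    field_simp
    linarith
  rw [hQ', hAeq]
  constructor
  · have : (0 : ℝ) ≤ R / (w * Q) := by positivity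
    linarith
  · gcongr
    rw [div_le_iff₀ (by positivity)]
    linarith

end Orbits

/-! ### The surface obtained from a single cylinder -/

section Frame

variable {ι : Type*} {m : ι → ℕ}

theorem viaEmbedding_coneRotation_pow_apply {β : Type*} (f : ConeCorner m ↪ β) (i : ι)
    (t : ZMod (m i + 1)) (n : ℕ) :
    ((coneRotation m 1).viaEmbedding f ^ n) (f ⟨i, t⟩) = f ⟨i, t + n⟩ := by
  induction n with
  | zero => simp
  | succ n ih =>
    rw [pow_succ', Perm.mul_apply, ih, Perm.viaEmbedding_apply, coneRotation_apply, Pi.one_apply]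
    push_cast
    rw [add_assoc]

/-- The cycle of a framed corner is the set of all framed corners at the same zero. -/
theorem sameCycle_viaEmbedding_coneRotation_iff {β : Type*} [Finite β] (f : ConeCorner m ↪ β)
    (i : ι) (t : ZMod (m i + 1)) (y : β) :
    ((coneRotation m 1).viaEmbedding f).SameCycle (f ⟨i, t⟩) y ↔ ∃ t', y = f ⟨i, t'⟩ := by
  constructor
  · intro h
    obtain ⟨n, -, rfl⟩ := h.exists_pow_eq'
    exact ⟨_, viaEmbedding_coneRotation_pow_apply f i t n⟩
  · rintro ⟨t', rfl⟩
    refine ⟨((t' - t).val : ℕ), ?_⟩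
    rw [zpow_natCast, viaEmbedding_coneRotation_pow_apply, ZMod.natCast_zmod_val,
      add_sub_cancel]

theorem sameCycle_viaEmbedding_of_notMem {κ β : Type*} (π : Perm κ) (f : κ ↪ β) {y z : β}
    (hy : y ∉ Set.range f) (h : (π.viaEmbedding f).SameCycle y z) : z = y := by
  obtain ⟨n, rfl⟩ := h
  exact Perm.zpow_apply_eq_self_of_apply_eq_self (Perm.viaEmbedding_apply_of_notMem _ _ _ hy) n

/-- The commutator determines the frame once one corner of each zero is known. -/
theorem FramedGluing.ext_of_base {w : ℕ} {p q : FramedGluing (coneRotation m 1) w}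
    (h1 : ∀ x, p.1.1 x = q.1.1 x) (h2 : ∀ i, p.1.2 ⟨i, 0⟩ = q.1.2 ⟨i, 0⟩) : p = q := by
  refine FramedGluing.ext' h1 fun ⟨i, t⟩ => ?_
  have h3 : (coneRotation m 1).viaEmbedding p.1.2 = (coneRotation m 1).viaEmbedding q.1.2 := by
    rw [← p.2, ← q.2, Equiv.ext h1]
  have hp := viaEmbedding_coneRotation_pow_apply p.1.2 i 0 t.val
  have hq := viaEmbedding_coneRotation_pow_apply q.1.2 i 0 t.val
  rw [ZMod.natCast_zmod_val, zero_add] at hp hq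
  rw [← hp, ← hq, h3, h2]

end Frame

namespace SquareTiledSurface

variable {ι : Type} {m : ι → ℕ}

theorem corner_eq_corner_iff {S : SquareTiledSurface m} {x y : Fin S.numSquares} :
    S.corner x = S.corner y ↔ (S.up⁻¹ * S.right⁻¹ * S.up * S.right).SameCycle x y :=
  Quotient.eq

theorem quotientMk_eq_iff {β : Type*} {c c' : Perm β} (h : c = c') {x y : β} :
    (Quotient.mk (Perm.SameCycle.setoid c) x = Quotient.mk _ y) ↔ c'.SameCycle x y := by
  subst h; exact Quotient.eq

/-- The square-tiled surface given by two permutations and a numbering of the squares around each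
labelled point. -/
def ofFrame {n : ℕ} (hn : 0 < n) (r u : Perm (Fin n))
    (hconn : ∀ x y, ∃ p ∈ Subgroup.closure {r, u}, p x = y) (f : ConeCorner m ↪ Fin n)
    (hf : u⁻¹ * r⁻¹ * u * r = (coneRotation m 1).viaEmbedding f) : SquareTiledSurface m where
  numSquares := n
  numSquares_pos := hn
  right := r
  up := u
  connected := hconn
  point i := Quotient.mk _ (f ⟨i, 0⟩)
  point_injective i i' h := by
    obtain ⟨t', h⟩ := (sameCycle_viaEmbedding_coneRotation_iff f i 0 _).1
      ((quotientMk_eq_iff hf).1 h)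
    exact (congrArg Sigma.fst (f.injective h)).symm
  card_point i := by
    have key (x : Fin n) : (Quotient.mk _ x : Quotient (Perm.SameCycle.setoid
        (u⁻¹ * r⁻¹ * u * r))) = Quotient.mk _ (f ⟨i, 0⟩) ↔ ∃ t, f ⟨i, t⟩ = x := by
      rw [eq_comm, quotientMk_eq_iff hf, sameCycle_viaEmbedding_coneRotation_iff]
      simp only [eq_comm]
    rw [Nat.card_congr (Equiv.subtypeEquivRight key)]
    have hinj : Function.Injective fun t : ZMod (m i + 1) => f ⟨i, t⟩ := fun t t' h => by
      simpa using f.injective h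
    exact (Nat.card_congr (Equiv.ofInjective _ hinj)).symm.trans (Nat.card_zmod _)
  card_of_notMem P hP := by
    induction P using Quotient.inductionOn with | h x => ?_
    have hx : x ∉ Set.range f := by
      rintro ⟨⟨i, t⟩, rfl⟩
      refine hP ⟨i, (quotientMk_eq_iff hf).2 ?_⟩
      rw [sameCycle_viaEmbedding_coneRotation_iff]
      exact ⟨t, rfl⟩
    have key (y : Fin n) : (Quotient.mk _ y : Quotient (Perm.SameCycle.setoid
        (u⁻¹ * r⁻¹ * u * r))) = Quotient.mk _ x ↔ y = x := by
      rw [eq_comm, quotientMk_eq_iff hf]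
      exact ⟨sameCycle_viaEmbedding_of_notMem _ _ hx, fun h => h ▸ .refl _ _⟩
    rw [Nat.card_congr (Equiv.subtypeEquivRight key)]
    simp

/-- The bijection `E` exhibits a surface as a single horizontal cylinder of height `h` and
circumference `w`: the square `E (j, x)` is in the `x`-th column, `j` rows below the top row, and
the top of the cylinder is glued to its bottom by `p`. -/
structure IsCylinder (S : SquareTiledSurface m) {h w : ℕ} (p : FramedGluing (coneRotation m 1) w)
    (E : ZMod h × ZMod w ≃ Fin S.numSquares) : Prop where
  right_apply : ∀ j x, S.right (E (j, x)) = E (j, x + 1)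
  up_apply_zero : ∀ x, S.up (E (0, x)) = E (-1, p.1.1 x)
  up_apply : ∀ j x, j ≠ 0 → S.up (E (j, x)) = E (j - 1, x)
  corner_eq_iff : ∀ i y, S.corner (E y) = S.point i ↔ ∃ t, y = (0, p.1.2 ⟨i, t⟩)

/-- The gluing of the rows of a cylinder of height `h` to the rows above them. -/
def cylinderUp (h : ℕ) {w : ℕ} (ρ : Perm (ZMod w)) : Perm (ZMod h × ZMod w) :=
  Equiv.prodShear (Equiv.subRight 1) fun j => if j = 0 then ρ else 1

/-- Every gluing of the top of a cylinder to its bottom is realised by a surface. -/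
theorem exists_isCylinder (h : ℕ) {w : ℕ} [NeZero h] [NeZero w]
    (p : FramedGluing (coneRotation m 1) w) :
    ∃ (S : SquareTiledSurface m) (E : ZMod h × ZMod w ≃ Fin S.numSquares), S.IsCylinder p E := by
  classical
  have hcard : Fintype.card (ZMod h × ZMod w) = Fintype.card (Fin (h * w)) := by simp
  let E : ZMod h × ZMod w ≃ Fin (h * w) := Fintype.equivOfCardEq hcard
  let r₀ : Perm (ZMod h × ZMod w) := Equiv.prodCongr (1 : Perm (ZMod h)) (cyclicShift w)
  let u₀ : Perm (ZMod h × ZMod w) := cylinderUp h p.1.1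
  have hr₀ (j x) : r₀ (j, x) = (j, x + 1) := rfl
  have hr₀' (j x) : r₀⁻¹ (j, x) = (j, x - 1) := by
    rw [Perm.inv_eq_iff_eq, hr₀, sub_add_cancel]
  have hu₀ (x) : u₀ (0, x) = (-1, p.1.1 x) := by simp [u₀, cylinderUp]
  have hu₀' (j x) (hj : j ≠ 0) : u₀ (j, x) = (j - 1, x) := by simp [u₀, cylinderUp, hj]
  let f₀ : ConeCorner m ↪ ZMod h × ZMod w :=
    ⟨fun k => (0, p.1.2 k), fun k k' hk => by simpa using hk⟩
  have hcomm : u₀⁻¹ * r₀⁻¹ * u₀ * r₀ = (coneRotation m 1).viaEmbedding f₀ := by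
    have hp (x) : p.1.1⁻¹ (p.1.1 (x + 1) - 1) = (coneRotation m 1).viaEmbedding p.1.2 x := by
      rw [← p.2]
      simp [cyclicShift, sub_eq_add_neg]
    have hrow (x) : (u₀⁻¹ * r₀⁻¹ * u₀ * r₀) (0, x) =
        (0, (coneRotation m 1).viaEmbedding p.1.2 x) := by
      rw [← hp]
      simp only [Perm.mul_apply, hr₀, hu₀, hr₀']
      rw [Perm.inv_eq_iff_eq, hu₀]
      simp
    rw [eq_viaEmbedding_iff]
    constructor
    · intro k
      change _ = (_, p.1.2 (coneRotation m 1 k))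
      rw [← Perm.viaEmbedding_apply]
      exact hrow _
    · rintro ⟨j, x⟩ hy
      by_cases hj : j = 0
      · subst hj
        rw [hrow, Perm.viaEmbedding_apply_of_notMem]
        rintro ⟨k, rfl⟩
        exact hy ⟨k, rfl⟩
      · simp only [Perm.mul_apply, hr₀, hu₀' _ _ hj, hr₀']
        rw [Perm.inv_eq_iff_eq, hu₀' _ _ hj, add_sub_cancel_right]
  let r := E.permCongr r₀
  let u := E.permCongr u₀
  have hr (y) : r (E y) = E (r₀ y) := by simp [r]
  have hu (y) : u (E y) = E (u₀ y) := by simp [u]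
  have hf : u⁻¹ * r⁻¹ * u * r = (coneRotation m 1).viaEmbedding (f₀.trans E.toEmbedding) := by
    rw [viaEmbedding_trans_equiv, ← hcomm]
    exact ((map_mul E.permCongrHom (u₀⁻¹ * r₀⁻¹ * u₀) r₀).trans (by
      rw [map_mul, map_mul, map_inv, map_inv]; rfl)).symm
  have hconn : ∀ x y, ∃ q ∈ Subgroup.closure {r, u}, q x = y := by
    have hrmem : r ∈ Subgroup.closure {r, u} := Subgroup.subset_closure (by simp)
    have humem : u ∈ Subgroup.closure {r, u} := Subgroup.subset_closure (by simp)
    have h0 : ∀ x : ZMod w, ∃ q ∈ Subgroup.closure {r, u}, q (E (0, 0)) = E (0, x) := by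
      intro x
      obtain ⟨n, rfl⟩ := ZMod.natCast_zmod_surjective x
      refine ⟨r ^ n, pow_mem hrmem n, ?_⟩
      induction n with
      | zero => simp
      | succ n ih => rw [pow_succ', Perm.mul_apply, ih, hr, hr₀]; push_cast; rfl
    have h1 : ∀ y, ∃ q ∈ Subgroup.closure {r, u}, q (E (0, 0)) = E y := by
      rintro ⟨j, x⟩
      obtain ⟨n, rfl⟩ := ZMod.natCast_zmod_surjective j
      induction n with
      | zero => simpa using h0 x
      | succ n ih =>
        by_cases hj : ((n + 1 : ℕ) : ZMod h) = 0
        · rw [hj]; exact h0 x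
        · obtain ⟨q, hq, hq'⟩ := ih
          refine ⟨u⁻¹ * q, mul_mem (inv_mem humem) hq, ?_⟩
          rw [Perm.mul_apply, hq', Perm.inv_eq_iff_eq, hu, hu₀' _ _ hj]
          simp
    intro x y
    obtain ⟨q, hq, hx⟩ := h1 (E.symm x)
    obtain ⟨q', hq', hy⟩ := h1 (E.symm y)
    rw [apply_symm_apply] at hx hy
    refine ⟨q' * q⁻¹, mul_mem hq' (inv_mem hq), ?_⟩
    rw [← hx, ← hy]; simp
  refine ⟨ofFrame (Nat.mul_pos (NeZero.pos h) (NeZero.pos w)) r u hconn _ hf, E, ?_, ?_, ?_, ?_⟩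
  · intro j x; exact hr _
  · intro x; exact (hu _).trans (congrArg E (hu₀ x))
  · intro j x hj; exact (hu _).trans (congrArg E (hu₀' j x hj))
  · intro i y
    refine eq_comm.trans ((quotientMk_eq_iff hf).trans
      ((sameCycle_viaEmbedding_coneRotation_iff (f₀.trans E.toEmbedding) i 0 (E y)).trans ?_))
    exact exists_congr fun t => E.injective.eq_iff

namespace IsCylinder

variable {S : SquareTiledSurface m} {h w : ℕ} {p : FramedGluing (coneRotation m 1) w}
  {E : ZMod h × ZMod w ≃ Fin S.numSquares}

theorem numSquares_eq (_ : S.IsCylinder p E) : S.numSquares = h * w := by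
  have := Nat.card_congr E
  simpa using this.symm

theorem sameCycle_right (hS : S.IsCylinder p E) (j : ZMod h) (x x' : ZMod w) :
    S.right.SameCycle (E (j, x)) (E (j, x')) := by
  obtain ⟨n, hn⟩ := ZMod.intCast_surjective (x' - x)
  have key (n : ℕ) (x : ZMod w) : (S.right ^ n) (E (j, x)) = E (j, x + n) := by
    induction n with
    | zero => simp
    | succ n ih =>
      rw [pow_succ', Perm.mul_apply, ih, hS.right_apply]; push_cast; rw [add_assoc]
  rcases Int.eq_nat_or_neg n with ⟨k, rfl | rfl⟩
  · refine ⟨k, ?_⟩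
    rw [zpow_natCast, key]
    push_cast at hn
    rw [hn, add_sub_cancel]
  · refine Perm.SameCycle.symm ⟨k, ?_⟩
    rw [zpow_natCast, key]
    push_cast at hn
    rw [show x' + (k : ZMod w) = x by linear_combination -hn]

theorem exists_eq_of_sameCycle_right (hS : S.IsCylinder p E) {j : ZMod h} {x : ZMod w}
    {z : Fin S.numSquares} (hz : S.right.SameCycle (E (j, x)) z) : ∃ x', z = E (j, x') := by
  obtain ⟨n, -, rfl⟩ := hz.exists_pow_eq'
  clear hz
  induction n with
  | zero => exact ⟨x, rfl⟩
  | succ n ih =>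
    obtain ⟨x', hx'⟩ := ih
    exact ⟨x' + 1, by rw [pow_succ', Perm.mul_apply, hx', hS.right_apply]⟩

theorem regularTop (hS : S.IsCylinder p E) {j : ZMod h} (hj : j ≠ 0) (x : ZMod w) :
    S.RegularTop (E (j, x)) := by
  rintro z hz ⟨i, hi⟩
  obtain ⟨x', hx'⟩ := hS.exists_eq_of_sameCycle_right hz
  rw [hx'] at hi
  obtain ⟨t, ht⟩ := (hS.corner_eq_iff i _).1 hi.symm
  exact hj (congrArg Prod.fst ht)

theorem numCylinders_eq_one [NeZero h] (hS : S.IsCylinder p E) : S.numCylinders = 1 := by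
  rw [numCylinders, Nat.card_eq_one_iff_unique]
  have hrow (j : ZMod h) (x x' : ZMod w) : Quot.mk S.CylinderAdj (E (j, x)) =
      Quot.mk S.CylinderAdj (E (j, x')) := by
    obtain ⟨n, -, hn⟩ := (hS.sameCycle_right j x x').exists_pow_eq'
    rw [← hn]
    clear hn
    induction n with
    | zero => rfl
    | succ n ih =>
      rw [ih]
      exact Quot.sound (Or.inl (by rw [pow_succ', Perm.mul_apply]))
  have hcol (j : ZMod h) (x : ZMod w) : Quot.mk S.CylinderAdj (E (j, x)) =
      Quot.mk S.CylinderAdj (E (0, x)) := by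
    obtain ⟨n, rfl⟩ := ZMod.natCast_zmod_surjective j
    induction n with
    | zero => simp
    | succ n ih =>
      by_cases hj : ((n + 1 : ℕ) : ZMod h) = 0
      · rw [hj]
      · rw [← ih]
        refine Quot.sound (Or.inr ⟨?_, hS.regularTop hj x⟩)
        rw [hS.up_apply _ _ hj]
        simp
  refine ⟨⟨fun a b => ?_⟩, ⟨Quot.mk _ ⟨0, S.numSquares_pos⟩⟩⟩
  induction a using Quot.ind with | mk a => ?_
  induction b using Quot.ind with | mk b => ?_
  obtain ⟨⟨j, x⟩, rfl⟩ := E.surjective a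
  obtain ⟨⟨j', x'⟩, rfl⟩ := E.surjective b
  rw [hcol, hcol j', hrow 0 x x']

variable {S' : SquareTiledSurface m} {h' w' : ℕ} {p' : FramedGluing (coneRotation m 1) w'}
  {E' : ZMod h' × ZMod w' ≃ Fin S'.numSquares}

/-- An isomorphism between one-cylinder surfaces is a rotation on the top row. -/
theorem exists_apply_zero_eq [Nonempty ι] (hS : S.IsCylinder p E) (hS' : S'.IsCylinder p' E')
    {e : Fin S.numSquares ≃ Fin S'.numSquares} (hr : ∀ x, e (S.right x) = S'.right (e x))
    (hp : ∀ i x, S.corner x = S.point i ↔ S'.corner (e x) = S'.point i) :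
    ∃ a : ZMod w', ∀ n : ℤ, e (E (0, n)) = E' (0, a + n) := by
  obtain ⟨i⟩ := ‹Nonempty ι›
  have h1 : S.corner (E (0, p.1.2 ⟨i, 0⟩)) = S.point i := (hS.corner_eq_iff i _).2 ⟨0, rfl⟩
  rw [hp] at h1
  obtain ⟨y, hy⟩ := E'.surjective (e (E (0, p.1.2 ⟨i, 0⟩)))
  rw [← hy, hS'.corner_eq_iff] at h1
  obtain ⟨t, rfl⟩ := h1
  obtain ⟨k, hk⟩ := ZMod.intCast_surjective (p.1.2 ⟨i, 0⟩)
  refine ⟨p'.1.2 ⟨i, t⟩ - k, fun n => ?_⟩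
  have key : ∀ d : ℤ, e (E (0, k + d)) = E' (0, p'.1.2 ⟨i, t⟩ + d) := by
    intro d
    induction d using Int.induction_on with
    | zero => simp [hk, hy]
    | succ d ih =>
      push_cast at ih ⊢
      rw [← add_assoc, ← hS.right_apply, hr, ih, hS'.right_apply, add_assoc]
    | pred d ih =>
      apply S'.right.injective
      rw [← hr, hS.right_apply, hS'.right_apply]
      push_cast at ih ⊢
      rw [add_assoc, sub_add_cancel, ih, add_assoc, sub_add_cancel]
  have := key (n - k)
  push_cast at this
  rw [add_sub_cancel] at this
  rw [this]; congr 2; ring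

/-- Since the isomorphism translates the top row, the circumference of the source is a period of the
target. -/
theorem dvd_of_iso [Nonempty ι] (hS : S.IsCylinder p E) (hS' : S'.IsCylinder p' E')
    (hiso : S.Iso S') : w' ∣ w := by
  obtain ⟨e, hr, -, hp⟩ := hiso
  obtain ⟨a, ha⟩ := hS.exists_apply_zero_eq hS' hr hp
  have h1 := ha w
  have h2 := ha 0
  simp only [Int.cast_natCast, CharP.cast_eq_zero, Int.cast_zero] at h1 h2
  rw [h1, E'.injective.eq_iff] at h2
  simpa [ZMod.natCast_eq_zero_iff] using h2

theorem width_eq_of_iso [Nonempty ι] (hS : S.IsCylinder p E) (hS' : S'.IsCylinder p' E')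
    (hiso : S.Iso S') : w = w' :=
  Nat.dvd_antisymm (hS'.dvd_of_iso hS (iso_equivalence.symm hiso)) (hS.dvd_of_iso hS' hiso)

theorem height_eq_of_iso [Nonempty ι] [NeZero w] (hS : S.IsCylinder p E)
    (hS' : S'.IsCylinder p' E') (hiso : S.Iso S') : h = h' := by
  have h1 := hS.width_eq_of_iso hS' hiso
  obtain ⟨e, -⟩ := hiso
  have h2 : S.numSquares = S'.numSquares := by simpa using Nat.card_congr e
  rw [hS.numSquares_eq, hS'.numSquares_eq, ← h1] at h2
  exact Nat.eq_of_mul_eq_mul_right (NeZero.pos w) h2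

end IsCylinder

namespace IsCylinder

variable {S S' : SquareTiledSurface m} {h w : ℕ} {p p' : FramedGluing (coneRotation m 1) w}
  {E : ZMod h × ZMod w ≃ Fin S.numSquares} {E' : ZMod h × ZMod w ≃ Fin S'.numSquares}

/-- A rotation of the cylinder and a change of base corners do not change the surface. -/
theorem iso_of_vadd_eq (hS : S.IsCylinder p E) (hS' : S'.IsCylinder p' E')
    (g : ZMod w × ∀ i, ZMod (m i + 1)) (hg : g +ᵥ p = p') : S.Iso S' := by
  subst hg
  let φ : ZMod h × ZMod w ≃ ZMod h × ZMod w := Equiv.prodCongr (Equiv.refl _) (Equiv.addRight g.1)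
  have hφ (j x) : φ (j, x) = (j, x + g.1) := rfl
  refine ⟨(E.symm.trans φ).trans E', fun z => ?_, fun z => ?_, fun i z => ?_⟩
  · obtain ⟨⟨j, x⟩, rfl⟩ := E.surjective z
    rw [hS.right_apply]
    simp only [trans_apply, symm_apply_apply, hφ, hS'.right_apply]
    rw [add_right_comm]
  · obtain ⟨⟨j, x⟩, rfl⟩ := E.surjective z
    by_cases hj : j = 0
    · subst hj
      rw [hS.up_apply_zero]
      simp only [trans_apply, symm_apply_apply, hφ, hS'.up_apply_zero, vadd_val_fst]
      rw [add_sub_cancel_right]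
    · rw [hS.up_apply _ _ hj]
      simp only [trans_apply, symm_apply_apply, hφ, hS'.up_apply _ _ hj]
  · obtain ⟨⟨j, x⟩, rfl⟩ := E.surjective z
    rw [hS.corner_eq_iff]
    simp only [trans_apply, symm_apply_apply, hφ]
    rw [hS'.corner_eq_iff]
    simp only [vadd_val_snd, coneRotation_apply, Prod.mk.injEq, add_left_inj]
    constructor
    · rintro ⟨t, h1, h2⟩
      exact ⟨t - g.2 i, h1, by rw [h2, sub_add_cancel]⟩
    · rintro ⟨t, h1, h2⟩
      exact ⟨t + g.2 i, h1, h2⟩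

/-- Isomorphic surfaces come from gluings that differ by a rotation and a change of base corners. -/
theorem exists_vadd_eq_of_iso [Nonempty ι] [NeZero h] (hS : S.IsCylinder p E)
    (hS' : S'.IsCylinder p' E') (hiso : S.Iso S') :
    ∃ g : ZMod w × ∀ i, ZMod (m i + 1), g +ᵥ p = p' := by
  obtain ⟨e, hr, hu, hp⟩ := hiso
  obtain ⟨a, ha⟩ := hS.exists_apply_zero_eq hS' hr hp
  have ha' (x : ZMod w) : e (E (0, x)) = E' (0, x + a) := by
    obtain ⟨n, rfl⟩ := ZMod.intCast_surjective x
    rw [ha, add_comm]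
  -- Follow a column upwards from the bottom row: after `h - 1` steps the top row is reached, where
  -- the isomorphism is known.
  have hρ (x : ZMod w) : p'.1.1 (x + a) = p.1.1 x + a := by
    have h1 : ∀ n : ℕ, n < h → e (E (-1 - n, p.1.1 x)) = E' (-1 - n, p'.1.1 (x + a)) := by
      intro n
      induction n with
      | zero =>
        intro _
        rw [Nat.cast_zero, sub_zero, ← hS.up_apply_zero, hu, ha', hS'.up_apply_zero]
      | succ n ih =>
        intro hn
        have hne : (-1 - n : ZMod h) ≠ 0 := by
          intro h0
          have : ((n + 1 : ℕ) : ZMod h) = 0 := by push_cast; linear_combination -h0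
          rw [ZMod.natCast_eq_zero_iff] at this
          exact absurd (Nat.le_of_dvd (Nat.succ_pos n) this) (by omega)
        have h2 := ih (by omega)
        have h3 := hu (E (-1 - n, p.1.1 x))
        rw [hS.up_apply _ _ hne, h2, hS'.up_apply _ _ hne] at h3
        push_cast
        rw [← sub_sub]
        exact h3
    have hh : 0 < h := NeZero.pos h
    have h2 := h1 (h - 1) (by omega)
    have h3 : (-1 - (h - 1 : ℕ) : ZMod h) = 0 := by
      rw [Nat.cast_sub hh, CharP.cast_eq_zero]; simp
    rw [h3, ha', E'.injective.eq_iff] at h2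
    exact (congrArg Prod.snd h2).symm
  have hb (i : ι) : ∃ b : ZMod (m i + 1), p'.1.2 ⟨i, 0⟩ = p.1.2 ⟨i, b⟩ + a := by
    have h1 : S'.corner (E' (0, p'.1.2 ⟨i, 0⟩)) = S'.point i := (hS'.corner_eq_iff i _).2 ⟨0, rfl⟩
    rw [← sub_add_cancel (p'.1.2 ⟨i, 0⟩) a, ← ha', ← hp, hS.corner_eq_iff] at h1
    obtain ⟨t, ht⟩ := h1
    exact ⟨t, sub_eq_iff_eq_add.1 (congrArg Prod.snd ht)⟩
  choose b hb using hb
  refine ⟨(a, b), FramedGluing.ext_of_base (fun x => ?_) fun i => ?_⟩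
  · rw [vadd_val_fst, ← hρ, sub_add_cancel]
  · rw [vadd_val_snd, hb, coneRotation_apply, zero_add]

end IsCylinder

end SquareTiledSurface

/-! ### Surfaces with one maximal cylinder are single cylinders -/

theorem perm_apply_inv_apply {α : Type*} (f : Perm α) (x : α) : f (f⁻¹ x) = x :=
  f.apply_symm_apply x

theorem perm_inv_apply_apply {α : Type*} (f : Perm α) (x : α) : f⁻¹ (f x) = x :=
  f.symm_apply_apply x

namespace SquareTiledSurface

variable {ι : Type} {m : ι → ℕ} (S : SquareTiledSurface m)

theorem regularTop_congr {x y : Fin S.numSquares} (h : S.right.SameCycle x y) :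
    S.RegularTop x ↔ S.RegularTop y :=
  ⟨fun hx z hz => hx z (h.trans hz), fun hy z hz => hy z (h.symm.trans hz)⟩

theorem regularTop_zpow {x : Fin S.numSquares} (k : ℤ) :
    S.RegularTop ((S.right ^ k) x) ↔ S.RegularTop x :=
  (S.regularTop_congr ⟨k, rfl⟩).symm

/-- The commutator fixes the squares whose top right corner is not labelled. -/
theorem commutator_apply_eq_self {z : Fin S.numSquares} (hz : S.corner z ∉ Set.range S.point) :
    (S.up⁻¹ * S.right⁻¹ * S.up * S.right) z = z := by
  have h := S.card_of_notMem (S.corner z) hz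
  rw [Nat.card_eq_one_iff_unique] at h
  have h1 := h.1.elim ⟨(S.up⁻¹ * S.right⁻¹ * S.up * S.right) z,
    (corner_eq_corner_iff (S := S)).2 (Perm.sameCycle_apply_left.2 (.refl _ _))⟩ ⟨z, rfl⟩
  exact congrArg Subtype.val h1

theorem up_right_of_regularTop {z : Fin S.numSquares} (hz : S.RegularTop z) :
    S.up (S.right z) = S.right (S.up z) := by
  have h := S.commutator_apply_eq_self (hz z (.refl _ _))
  simp only [Perm.mul_apply] at h
  rwa [Perm.inv_eq_iff_eq, Perm.inv_eq_iff_eq] at h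

theorem up_zpow_right_of_regularTop {z : Fin S.numSquares} (hz : S.RegularTop z) (k : ℤ) :
    S.up ((S.right ^ k) z) = (S.right ^ k) (S.up z) := by
  induction k using Int.induction_on with
  | zero => rfl
  | succ k ih =>
    rw [add_comm, zpow_one_add, Perm.mul_apply,
      S.up_right_of_regularTop ((S.regularTop_zpow _).2 hz), ih, Perm.mul_apply]
  | pred k ih =>
    have h (y) : S.right ((S.right ^ (-k - 1 : ℤ)) y) = (S.right ^ (-k : ℤ)) y := by
      rw [← Perm.mul_apply, ← zpow_one_add, add_sub_cancel]
    apply S.right.injective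
    rw [← S.up_right_of_regularTop ((S.regularTop_zpow _).2 hz), h, h, ih]

/-- Climbing up inside a cylinder commutes with moving horizontally. -/
theorem pow_up_zpow_right {z : Fin S.numSquares} {n : ℕ}
    (hz : ∀ i < n, S.RegularTop ((S.up ^ i) z)) (k : ℤ) :
    (S.up ^ n) ((S.right ^ k) z) = (S.right ^ k) ((S.up ^ n) z) := by
  induction n with
  | zero => rfl
  | succ n ih =>
    rw [pow_succ', Perm.mul_apply, ih fun i hi => hz i (by omega),
      S.up_zpow_right_of_regularTop (hz n (by omega)), Perm.mul_apply]

/-- The row of `z₀` is reached from `z` by climbing inside the cylinder of `z`. -/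
def ClimbsTo (z₀ z : Fin S.numSquares) : Prop :=
  ∃ n, S.right.SameCycle ((S.up ^ n) z) z₀ ∧ ∀ i < n, S.RegularTop ((S.up ^ i) z)

variable {S}

theorem ClimbsTo.zpow_right {z₀ z : Fin S.numSquares} (h : S.ClimbsTo z₀ z) (k : ℤ) :
    S.ClimbsTo z₀ ((S.right ^ k) z) := by
  obtain ⟨n, h1, h2⟩ := h
  refine ⟨n, ?_, fun i hi => ?_⟩
  · rw [S.pow_up_zpow_right h2, Perm.sameCycle_zpow_left]
    exact h1
  · rw [S.pow_up_zpow_right fun j hj => h2 j (by omega), S.regularTop_zpow]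
    exact h2 i hi

/-- If the top of the row of `z₀` meets a labelled point, climbing to this row is a property of the
maximal cylinder. -/
theorem climbsTo_iff_of_cylinderAdj {z₀ x y : Fin S.numSquares} (hz₀ : ¬ S.RegularTop z₀)
    (h : S.CylinderAdj x y) : S.ClimbsTo z₀ x ↔ S.ClimbsTo z₀ y := by
  rcases h with rfl | ⟨rfl, hx⟩
  · refine ⟨fun h => by simpa using h.zpow_right 1, fun h => ?_⟩
    simpa using h.zpow_right (-1)
  · constructor
    · rintro ⟨n, h1, h2⟩
      cases n with
      | zero => exact absurd ((S.regularTop_congr h1).1 hx) hz₀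
      | succ n =>
        refine ⟨n, ?_, fun i hi => ?_⟩
        · rwa [← Perm.mul_apply, ← pow_succ]
        · rw [← Perm.mul_apply, ← pow_succ]
          exact h2 _ (by omega)
    · rintro ⟨n, h1, h2⟩
      refine ⟨n + 1, ?_, fun i hi => ?_⟩
      · rwa [pow_succ, Perm.mul_apply]
      · cases i with
        | zero => exact hx
        | succ i =>
          rw [pow_succ, Perm.mul_apply]
          exact h2 _ (by omega)

theorem climbsTo_of_numCylinders_eq_one (h : S.numCylinders = 1) {z₀ : Fin S.numSquares}
    (hz₀ : ¬ S.RegularTop z₀) (z : Fin S.numSquares) : S.ClimbsTo z₀ z := by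
  rw [numCylinders, Nat.card_eq_one_iff_unique] at h
  have := h.1
  let D : Quot S.CylinderAdj → Prop := Quot.lift (S.ClimbsTo z₀) fun x y hxy =>
    propext (climbsTo_iff_of_cylinderAdj hz₀ hxy)
  have h0 : D (Quot.mk _ z₀) := ⟨0, .refl _ _, fun i hi => absurd hi (Nat.not_lt_zero i)⟩
  rw [Subsingleton.elim (Quot.mk _ z₀) (Quot.mk _ z)] at h0
  exact h0

/-- With a single maximal cylinder, there is only one row whose top meets a labelled point. -/
theorem sameCycle_of_not_regularTop (h : S.numCylinders = 1) {z₀ : Fin S.numSquares}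
    (hz₀ : ¬ S.RegularTop z₀) {z : Fin S.numSquares} (hz : ¬ S.RegularTop z) :
    S.right.SameCycle z₀ z := by
  obtain ⟨n, h1, h2⟩ := climbsTo_of_numCylinders_eq_one h hz₀ z
  cases n with
  | zero => exact h1.symm
  | succ n => exact absurd (h2 0 (Nat.succ_pos n)) hz

theorem not_regularTop_of_corner_eq {z : Fin S.numSquares} {i : ι} (h : S.corner z = S.point i) :
    ¬ S.RegularTop z :=
  fun hz => hz z (.refl _ _) ⟨i, h.symm⟩

variable (S) in
/-- The corners at the labelled points can be numbered cyclically. -/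
theorem exists_frame : ∃ f : ConeCorner m → Fin S.numSquares,
    (∀ k, (S.up⁻¹ * S.right⁻¹ * S.up * S.right) (f k) = f (coneRotation m 1 k)) ∧
    Function.Injective f ∧ ∀ i x, S.corner x = S.point i ↔ ∃ t, x = f ⟨i, t⟩ := by
  have key (i : ι) : ∃ e : ZMod (m i + 1) ≃ {x : Fin S.numSquares // S.corner x = S.point i},
      ∀ t, (e (t + 1)).1 = (S.up⁻¹ * S.right⁻¹ * S.up * S.right) (e t).1 := by
    have hp (x : Fin S.numSquares) :
        S.corner ((S.up⁻¹ * S.right⁻¹ * S.up * S.right) x) = S.point i ↔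
          S.corner x = S.point i := by
      have : S.corner ((S.up⁻¹ * S.right⁻¹ * S.up * S.right) x) = S.corner x :=
        corner_eq_corner_iff.2 (Perm.sameCycle_apply_left.2 (.refl _ _))
      rw [this]
    have hfull : IsFullCycle (Perm.subtypePerm (p := fun x => S.corner x = S.point i)
        (S.up⁻¹ * S.right⁻¹ * S.up * S.right) hp) := by
      rintro ⟨x, hx⟩ ⟨y, hy⟩
      rw [Perm.sameCycle_subtypePerm]
      exact corner_eq_corner_iff.1 (hx.trans hy.symm)
    obtain ⟨x₀, hx₀⟩ := Quotient.exists_rep (S.point i)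
    obtain ⟨e, -, he⟩ := hfull.exists_equiv_zmod ⟨x₀, hx₀⟩ (S.card_point i)
    exact ⟨e, fun t => congrArg Subtype.val (he t)⟩
  choose e he using key
  refine ⟨fun k => (e k.1 k.2).1, fun k => (he _ _).symm, ?_, fun i x => ⟨fun hx => ?_, ?_⟩⟩
  · rintro ⟨i, t⟩ ⟨i', t'⟩ h
    simp only at h
    have hii : i = i' := by
      apply S.point_injective
      rw [← (e i t).2, ← (e i' t').2, h]
    subst hii
    rw [(e i).injective (Subtype.ext h)]
  · exact ⟨(e i).symm ⟨x, hx⟩, by simp⟩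
  · rintro ⟨t, rfl⟩
    exact (e i t).2

/-- Cut the surface along the top of the only row `R` that meets a labelled point. Going down from
`R` commutes with moving right until one is back at `R`, and every square is passed on the way, so
this gives coordinates on the whole surface. -/
theorem exists_isCylinder_of_numCylinders_eq_one [Nonempty ι] (hS : S.numCylinders = 1) :
    ∃ (h w : ℕ) (_ : NeZero h) (_ : NeZero w) (p : FramedGluing (coneRotation m 1) w)
      (E : ZMod h × ZMod w ≃ Fin S.numSquares), S.IsCylinder p E := by
  classical
  obtain ⟨f, hfc, hfinj, hf⟩ := S.exists_frame
  obtain ⟨i₀⟩ := ‹Nonempty ι›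
  obtain ⟨z₀, hz₀⟩ : ∃ z₀, ¬ S.RegularTop z₀ :=
    ⟨f ⟨i₀, 0⟩, not_regularTop_of_corner_eq ((hf i₀ _).2 ⟨0, rfl⟩)⟩
  -- the top row `R` of the cylinder
  let R : Fin S.numSquares → Prop := fun z => S.right.SameCycle z₀ z
  have hR {z} : ¬ R z ↔ S.RegularTop z :=
    ⟨fun h => by_contra fun h' => h (sameCycle_of_not_regularTop hS hz₀ h'),
      fun h h' => hz₀ ((S.regularTop_congr h').2 h)⟩
  -- the height is the time at which the top row is reached again when one goes down
  have hex : ∃ n, 0 < n ∧ R ((S.up ^ n)⁻¹ z₀) :=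
    ⟨orderOf S.up, orderOf_pos _, by rw [pow_orderOf_eq_one]; exact .refl _ _⟩
  let h := Nat.find hex
  obtain ⟨hh0, hhR⟩ : 0 < h ∧ R ((S.up ^ h)⁻¹ z₀) := Nat.find_spec hex
  have hmin (n : ℕ) (hn0 : 0 < n) (hn : n < h) : ¬ R ((S.up ^ n)⁻¹ z₀) := fun hn' =>
    Nat.find_min hex hn ⟨hn0, hn'⟩
  have hup {i j : ℕ} (hij : j ≤ i) (z : Fin S.numSquares) :
      (S.up ^ j) ((S.up ^ i)⁻¹ z) = (S.up ^ (i - j))⁻¹ z := by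
    rw [Perm.eq_inv_iff_eq, ← Perm.mul_apply, ← pow_add, Nat.sub_add_cancel hij,
      perm_apply_inv_apply]
  have hdown₀ {i : ℕ} (hi : i < h) (k : ℤ) :
      (S.up ^ i)⁻¹ ((S.right ^ k) z₀) = (S.right ^ k) ((S.up ^ i)⁻¹ z₀) := by
    rw [Perm.inv_eq_iff_eq, S.pow_up_zpow_right, perm_apply_inv_apply]
    intro j hj
    rw [hup hj.le, ← hR]
    exact hmin _ (by omega) (by omega)
  have hnot {z} (hz : R z) {i : ℕ} (hi0 : 0 < i) (hi : i < h) : ¬ R ((S.up ^ i)⁻¹ z) := by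
    obtain ⟨k, rfl⟩ := hz
    rw [hdown₀ hi]
    exact fun h' => hmin i hi0 hi (Perm.sameCycle_zpow_right.1 h')
  have hdown {z} (hz : R z) {i : ℕ} (hi : i < h) :
      S.right ((S.up ^ i)⁻¹ z) = (S.up ^ i)⁻¹ (S.right z) := by
    have := S.pow_up_zpow_right (z := (S.up ^ i)⁻¹ z) (n := i) (fun j hj => by
      rw [hup hj.le, ← hR]
      exact hnot hz (by omega) (by omega)) 1
    rw [perm_apply_inv_apply, zpow_one] at this
    rw [Perm.eq_inv_iff_eq]; exact this
  -- All squares of the top row return to it at the same time.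
  have hret {z} (hz : R z) : R ((S.up ^ h)⁻¹ z) := by
    by_contra hy
    obtain ⟨k, rfl⟩ := id hz
    have h1 := S.pow_up_zpow_right (z := (S.up ^ h)⁻¹ ((S.right ^ k) z₀)) (n := h) (fun j hj => by
      rw [hup hj.le, ← hR]
      rcases Nat.eq_zero_or_pos j with rfl | hj0
      · exact hy
      · exact hnot hz (by omega) (by omega)) (-k)
    rw [perm_apply_inv_apply, zpow_neg, perm_inv_apply_apply, ← Perm.eq_inv_iff_eq] at h1
    rw [← h1, ← zpow_neg] at hhR
    exact hy (Perm.sameCycle_zpow_right.1 hhR)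
  have hret' {z} : R ((S.up ^ h) z) ↔ R z := by
    refine ⟨fun hz => by simpa using hret hz, fun hz => ?_⟩
    exact Perm.perm_symm_on_of_perm_on_finite (f := (S.up ^ h)⁻¹) (p := R) (fun x hx => hret hx) hz
  have hRr {z} : R (S.right z) ↔ R z := Perm.sameCycle_apply_right
  -- coordinates on the top row
  have hfull : IsFullCycle (S.right.subtypePerm (p := R) fun _ => hRr) := by
    rintro ⟨x, hx⟩ ⟨y, hy⟩
    rw [Perm.sameCycle_subtypePerm]
    exact hx.symm.trans hy
  obtain ⟨w, hw⟩ : ∃ w, Nat.card {z // R z} = w := ⟨_, rfl⟩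
  have hw0 : NeZero w := by
    have : Nonempty {z // R z} := ⟨⟨z₀, .refl _ _⟩⟩
    exact ⟨hw ▸ Nat.card_pos.ne'⟩
  have hh : NeZero h := ⟨hh0.ne'⟩
  obtain ⟨E₀, -, hE₀⟩ := hfull.exists_equiv_zmod ⟨z₀, .refl _ _⟩ hw
  have hE₀' (x) : (E₀ (x + 1)).1 = S.right (E₀ x).1 := congrArg Subtype.val (hE₀ x)
  let ρ : Perm (ZMod w) := E₀.symm.permCongr ((S.up ^ h).subtypePerm (p := R) fun _ => hret')
  have hρ (x) : (E₀ (ρ x)).1 = (S.up ^ h) (E₀ x).1 := by simp [ρ]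
  -- coordinates on the surface
  have hbij : Function.Bijective fun y : ZMod h × ZMod w => (S.up ^ y.1.val)⁻¹ (E₀ y.2).1 := by
    constructor
    · have aux (j j' : ZMod h) (x x' : ZMod w) (hjj : j.val ≤ j'.val)
          (heq : (S.up ^ j.val)⁻¹ (E₀ x).1 = (S.up ^ j'.val)⁻¹ (E₀ x').1) :
          (j, x) = (j', x') := by
        rw [Perm.inv_eq_iff_eq, hup hjj] at heq
        rcases hjj.eq_or_lt with hjj' | hjj'
        · rw [hjj', Nat.sub_self, pow_zero, inv_one, Perm.one_apply] at heq
          rw [ZMod.val_injective h hjj', E₀.injective (Subtype.ext heq)]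
        · have hlt := j'.val_lt
          exact absurd (heq ▸ (E₀ x).2) (hnot (E₀ x').2 (by omega) (by omega))
      rintro ⟨j, x⟩ ⟨j', x'⟩ heq
      rcases le_total j.val j'.val with hjj | hjj
      · exact aux j j' x x' hjj heq
      · exact (aux j' j x' x hjj heq.symm).symm
    · intro z
      obtain ⟨n, h1, h2⟩ := climbsTo_of_numCylinders_eq_one hS hz₀ z
      have hn : n < h := by
        by_contra hn
        push Not at hn
        have h3 := hret h1.symm
        have h4 : (S.up ^ h)⁻¹ ((S.up ^ n) z) = (S.up ^ (n - h)) z := by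
          rw [Perm.inv_eq_iff_eq, ← Perm.mul_apply, ← pow_add, Nat.add_sub_cancel' hn]
        rw [h4] at h3
        exact hR.2 (h2 (n - h) (by omega)) h3
      refine ⟨((n : ZMod h), E₀.symm ⟨(S.up ^ n) z, h1.symm⟩), ?_⟩
      simp [ZMod.val_natCast_of_lt hn]
  let E : ZMod h × ZMod w ≃ Fin S.numSquares := Equiv.ofBijective _ hbij
  have hE (j x) : E (j, x) = (S.up ^ j.val)⁻¹ (E₀ x).1 := rfl
  have hE0 (x) : E (0, x) = (E₀ x).1 := by rw [hE, ZMod.val_zero, pow_zero, inv_one]; rfl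
  have hright (j x) : S.right (E (j, x)) = E (j, x + 1) := by
    rw [hE, hE, hE₀', hdown (E₀ x).2 j.val_lt]
  have hzero (x) : S.up (E (0, x)) = E (-1, ρ x) := by
    have hv : (-1 : ZMod h).val = h - 1 := by
      obtain ⟨n, hn⟩ := Nat.exists_eq_succ_of_ne_zero hh0.ne'
      rw [hn, ZMod.val_neg_one]; rfl
    rw [hE0, hE, hρ, hv, Perm.eq_inv_iff_eq, ← Perm.mul_apply, ← pow_succ, Nat.sub_add_cancel hh0]
  have hne (j x) (hj : j ≠ 0) : S.up (E (j, x)) = E (j - 1, x) := by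
    have hj0 : 0 < j.val := Nat.pos_of_ne_zero fun h0 => hj ((ZMod.val_eq_zero j).1 h0)
    have hlt := j.val_lt
    have : Fact (1 < h) := ⟨by omega⟩
    have hv : (j - 1).val = j.val - 1 := by
      rw [ZMod.val_sub (by rw [ZMod.val_one]; omega), ZMod.val_one]
    have := hup (i := j.val) (j := 1) hj0 (E₀ x).1
    rw [pow_one] at this
    rw [hE, hE, hv, this]
  -- the frame lies on the top row
  have hfR (k) : R (f k) :=
    by_contra fun hk => not_regularTop_of_corner_eq ((hf k.1 _).2 ⟨k.2, rfl⟩) (hR.1 hk)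
  let f₀ : ConeCorner m ↪ ZMod w := ⟨fun k => E₀.symm ⟨f k, hfR k⟩, fun k k' hk => by
    have := E₀.symm.injective hk
    exact hfinj (congrArg Subtype.val this)⟩
  have hf₀ (k) : (E₀ (f₀ k)).1 = f k :=
    congrArg Subtype.val (E₀.apply_symm_apply ⟨f k, hfR k⟩)
  have hcomm (x) : E (0, (ρ⁻¹ * (cyclicShift w)⁻¹ * ρ * cyclicShift w) x) =
      (S.up⁻¹ * S.right⁻¹ * S.up * S.right) (E (0, x)) := by
    simp only [Perm.mul_apply, hright, hzero]
    symm
    rw [Perm.inv_eq_iff_eq, hzero, Perm.inv_eq_iff_eq, hright, perm_apply_inv_apply,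
      ← cyclicShift_apply x, ← cyclicShift_apply ((cyclicShift w)⁻¹ _), perm_apply_inv_apply]
  have hp : ρ⁻¹ * (cyclicShift w)⁻¹ * ρ * cyclicShift w = (coneRotation m 1).viaEmbedding f₀ := by
    rw [eq_viaEmbedding_iff]
    constructor
    · intro k
      have := hcomm (f₀ k)
      rw [hE0, hE0, hf₀, hfc, ← hf₀] at this
      exact E₀.injective (Subtype.ext this)
    · intro x hx
      have := hcomm x
      rw [S.commutator_apply_eq_self, hE0, hE0] at this
      · exact E₀.injective (Subtype.ext this)
      · rintro ⟨i, hi⟩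
        obtain ⟨t, ht⟩ := (hf i _).1 hi.symm
        rw [hE0, ← hf₀] at ht
        exact hx ⟨_, (E₀.injective (Subtype.ext ht)).symm⟩
  refine ⟨h, w, hh, hw0, ⟨(ρ, f₀), hp⟩, E, hright, hzero, hne, fun i y => ?_⟩
  rw [hf]
  refine exists_congr fun t => ?_
  rw [← hf₀, ← hE0, E.injective.eq_iff]

end SquareTiledSurface

/-! ### Counting one-cylinder surfaces by height and circumference -/

namespace SquareTiledSurface

variable {ι : Type} {m : ι → ℕ}

/-- The surface obtained from a cylinder of height `h` by gluing its top to its bottom. -/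
noncomputable def cylinderSurface (h : ℕ) {w : ℕ} [NeZero h] [NeZero w]
    (p : FramedGluing (coneRotation m 1) w) : SquareTiledSurface m :=
  (exists_isCylinder h p).choose

theorem exists_isCylinder_cylinderSurface (h : ℕ) {w : ℕ} [NeZero h] [NeZero w]
    (p : FramedGluing (coneRotation m 1) w) :
    ∃ E : ZMod h × ZMod w ≃ Fin (cylinderSurface h p).numSquares,
      (cylinderSurface h p).IsCylinder p E :=
  (exists_isCylinder h p).choose_spec

/-- The isomorphism class of the surface obtained from an isomorphism class of gluings. -/
noncomputable def surfaceClass (h w : ℕ) [NeZero h] [NeZero w] :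
    GluingClass m w → Quotient (SquareTiledSurface.setoid m) :=
  Quotient.map (cylinderSurface h) fun p q hpq => by
    obtain ⟨g, hg⟩ := hpq
    obtain ⟨E, hE⟩ := exists_isCylinder_cylinderSurface h p
    obtain ⟨E', hE'⟩ := exists_isCylinder_cylinderSurface h q
    exact iso_equivalence.symm (hE'.iso_of_vadd_eq hE g hg)

theorem surfaceClass_injective [Nonempty ι] (h w : ℕ) [NeZero h] [NeZero w] :
    Function.Injective (surfaceClass (m := m) h w) := by
  intro a b hab
  induction a using Quotient.inductionOn with | h p => ?_
  induction b using Quotient.inductionOn with | h q => ?_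
  obtain ⟨E, hE⟩ := exists_isCylinder_cylinderSurface h p
  obtain ⟨E', hE'⟩ := exists_isCylinder_cylinderSurface h q
  obtain ⟨g, hg⟩ := hE'.exists_vadd_eq_of_iso hE (iso_equivalence.symm (Quotient.exact hab))
  exact Quotient.sound ⟨g, hg⟩

theorem surfaceClass_eq_imp [Nonempty ι] {h w h' w' : ℕ} [NeZero h] [NeZero w] [NeZero h']
    [NeZero w'] {a : GluingClass m w} {b : GluingClass m w'}
    (hab : surfaceClass h w a = surfaceClass h' w' b) : h = h' ∧ w = w' := by
  induction a using Quotient.inductionOn with | h p => ?_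
  induction b using Quotient.inductionOn with | h q => ?_
  obtain ⟨E, hE⟩ := exists_isCylinder_cylinderSurface h p
  obtain ⟨E', hE'⟩ := exists_isCylinder_cylinderSurface h' q
  exact ⟨hE.height_eq_of_iso hE' (Quotient.exact hab), hE.width_eq_of_iso hE' (Quotient.exact hab)⟩

theorem surfaceClass_mem {h w N : ℕ} [NeZero h] [NeZero w] (hN : h * w ≤ N)
    (a : GluingClass m w) : surfaceClass h w a ∈ squareTiledSurfaces m 1 N := by
  induction a using Quotient.inductionOn with | h p => ?_
  obtain ⟨E, hE⟩ := exists_isCylinder_cylinderSurface h p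
  exact ⟨cylinderSurface h p, ⟨hE.numSquares_eq.trans_le hN, hE.numCylinders_eq_one⟩, rfl⟩

theorem exists_surfaceClass_eq [Nonempty ι] {N : ℕ} {s : Quotient (SquareTiledSurface.setoid m)}
    (hs : s ∈ squareTiledSurfaces m 1 N) :
    ∃ (h w : ℕ) (_ : NeZero h) (_ : NeZero w) (a : GluingClass m w),
      h * w ≤ N ∧ surfaceClass h w a = s := by
  obtain ⟨S, ⟨hSN, hS⟩, rfl⟩ := hs
  obtain ⟨h, w, hh, hw, p, E, hE⟩ := exists_isCylinder_of_numCylinders_eq_one hS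
  refine ⟨h, w, hh, hw, Quotient.mk _ p, hE.numSquares_eq ▸ hSN, Quotient.sound ?_⟩
  obtain ⟨E', hE'⟩ := exists_isCylinder_cylinderSurface h p
  exact hE'.iso_of_vadd_eq hE 0 (zero_vadd _ _)

end SquareTiledSurface

open SquareTiledSurface in
/-- One-cylinder surfaces with at most `N` squares, sorted by the height `h` and the circumference
`w` of the cylinder. -/
theorem ncard_squareTiledSurfaces_one {ι : Type} [Finite ι] [Nonempty ι] (m : ι → ℕ) (N : ℕ) :
    (squareTiledSurfaces m 1 N).ncard =
      ∑ h ∈ Finset.Icc 1 N, ∑ w ∈ Finset.Icc 1 (N / h), Nat.card (GluingClass m w) := by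
  classical
  let I : Finset (Σ _ : ℕ, ℕ) := (Finset.Icc 1 N).sigma fun h => Finset.Icc 1 (N / h)
  have hI {x : Σ _ : ℕ, ℕ} (hx : x ∈ I) : x.1 ≠ 0 ∧ x.2 ≠ 0 ∧ x.1 * x.2 ≤ N := by
    simp only [I, Finset.mem_sigma, Finset.mem_Icc] at hx
    refine ⟨by omega, by omega, ?_⟩
    rw [mul_comm]
    exact (Nat.le_div_iff_mul_le (by omega)).1 hx.2.2
  have hI' {h w : ℕ} (hh : h ≠ 0) (hw : w ≠ 0) (hN : h * w ≤ N) : (⟨h, w⟩ : Σ _ : ℕ, ℕ) ∈ I := by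
    simp only [I, Finset.mem_sigma, Finset.mem_Icc]
    refine ⟨⟨by omega, (Nat.le_mul_of_pos_right _ (by omega)).trans hN⟩, by omega, ?_⟩
    rw [Nat.le_div_iff_mul_le (by omega), mul_comm]
    exact hN
  have nz1 (x : I) : NeZero x.1.1 := ⟨(hI x.2).1⟩
  have nz2 (x : I) : NeZero x.1.2 := ⟨(hI x.2).2.1⟩
  let F : (Σ x : I, GluingClass m x.1.2) → squareTiledSurfaces m 1 N := fun y =>
    ⟨surfaceClass y.1.1.1 y.1.1.2 y.2, surfaceClass_mem (hI y.1.2).2.2 y.2⟩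
  have hF : Function.Bijective F := by
    constructor
    · rintro ⟨⟨⟨h, w⟩, hx⟩, a⟩ ⟨⟨⟨h', w'⟩, hx'⟩, b⟩ hab
      have hab := congrArg Subtype.val hab
      have h1 := nz1 ⟨⟨h, w⟩, hx⟩
      have h2 := nz2 ⟨⟨h, w⟩, hx⟩
      have h3 := nz1 ⟨⟨h', w'⟩, hx'⟩
      have h4 := nz2 ⟨⟨h', w'⟩, hx'⟩
      obtain ⟨rfl, rfl⟩ := surfaceClass_eq_imp hab
      obtain rfl := surfaceClass_injective h w hab
      rfl
    · rintro ⟨s, hs⟩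
      obtain ⟨h, w, hh, hw, a, hN, rfl⟩ := exists_surfaceClass_eq hs
      exact ⟨⟨⟨⟨h, w⟩, hI' hh.ne hw.ne hN⟩, a⟩, rfl⟩
  rw [← Nat.card_coe_set_eq, ← Nat.card_congr (Equiv.ofBijective F hF)]
  have := Fintype.ofFinite ι
  have hfin (x : I) : Finite (GluingClass m x.1.2) :=
    Quotient.finite _
  rw [Nat.card_sigma, Finset.sum_coe_sort I fun x => Nat.card (GluingClass m x.2),
    Finset.sum_sigma]

/-! ### Asymptotics of the sum over heights and circumferences -/

open Asymptotics in
/-- Summation of a sequence of polynomial growth. -/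
theorem tendsto_sum_div_pow {a : ℕ → ℝ} {c : ℝ} {k : ℕ}
    (ha : Tendsto (fun n : ℕ => a n / (n : ℝ) ^ k) atTop (𝓝 c)) :
    Tendsto (fun n : ℕ => (∑ i ∈ Finset.range n, a i) / (n : ℝ) ^ (k + 1)) atTop
      (𝓝 (c / (k + 1))) := by
  let g : ℕ → ℝ := fun n => ((n + 1 : ℕ) : ℝ) ^ (k + 1) - (n : ℝ) ^ (k + 1)
  have hgsum (n : ℕ) : ∑ i ∈ Finset.range n, g i = (n : ℝ) ^ (k + 1) := by
    rw [Finset.sum_range_sub (fun i : ℕ => (i : ℝ) ^ (k + 1))]; simp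
  have hg0 : 0 ≤ g := fun n => by
    simp only [g, Pi.zero_apply, sub_nonneg]
    gcongr; simp
  have hg : Tendsto (fun n : ℕ => g n / (n : ℝ) ^ k) atTop (𝓝 (k + 1)) := by
    have h1 : HasDerivAt (fun x : ℝ => (1 + x) ^ (k + 1)) (k + 1) 0 := by
      have := ((hasDerivAt_id (0 : ℝ)).const_add 1).fun_pow (k + 1)
      refine this.congr_deriv ?_
      simp
    have h2 := (hasDerivAt_iff_tendsto_slope_zero.1 h1).comp
      (tendsto_nhdsWithin_iff.2 ⟨tendsto_one_div_atTop_nhds_zero_nat (𝕜 := ℝ), by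
        filter_upwards [eventually_gt_atTop 0] with n hn
        simp [hn.ne']⟩)
    refine h2.congr' ?_
    filter_upwards [eventually_gt_atTop 0] with n hn
    have hn' : (n : ℝ) ≠ 0 := by exact_mod_cast hn.ne'
    simp only [Function.comp_apply, zero_add, g, smul_eq_mul, add_zero, one_pow]
    rw [show (1 + 1 / (n : ℝ)) = (n + 1) / n by field_simp, div_pow]
    push_cast
    field_simp
    ring
  have hlim : Tendsto (fun n : ℕ => (a n - c / (k + 1) * g n) / (n : ℝ) ^ k) atTop (𝓝 0) := by
    have := ha.sub (hg.const_mul (c / (k + 1)))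
    rw [div_mul_cancel₀ _ (by positivity), sub_self] at this
    refine this.congr fun n => ?_
    ring
  -- Compare with the differences `g` of `n ^ (k + 1)`, whose sum telescopes.
  have ho : (fun n : ℕ => a n - c / (k + 1) * g n) =o[atTop] g := by
    have h1 : (fun n : ℕ => a n - c / (k + 1) * g n) =o[atTop] fun n : ℕ => (n : ℝ) ^ k := by
      refine (isLittleO_iff_tendsto' ?_).2 hlim
      filter_upwards [eventually_gt_atTop 0] with n hn h
      have : (n : ℝ) ≠ 0 := by exact_mod_cast hn.ne'
      exact absurd h (pow_ne_zero _ this)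
    refine h1.trans_isBigO ?_
    refine IsBigO.of_bound 1 ?_
    filter_upwards with n
    have hle : (n : ℝ) ^ k ≤ g n := by
      have : (n : ℝ) ^ k * n + n ^ k ≤ ((n + 1 : ℕ) : ℝ) ^ (k + 1) := by
        rw [pow_succ, ← mul_add_one]
        push_cast
        gcongr
        linarith
      simp only [g]
      rw [pow_succ (n : ℝ)]
      linarith
    rw [one_mul, Real.norm_of_nonneg (by positivity), Real.norm_of_nonneg (hg0 n)]
    exact hle
  have hsum := ho.sum_range hg0 (by
    simp only [hgsum]
    exact (tendsto_pow_atTop (Nat.succ_ne_zero k)).comp tendsto_natCast_atTop_atTop)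
  simp only [hgsum, Finset.sum_sub_distrib, ← Finset.mul_sum] at hsum
  have h3 := hsum.tendsto_div_nhds_zero.add_const (c / (k + 1))
  rw [zero_add] at h3
  refine h3.congr' ?_
  filter_upwards [eventually_gt_atTop 0] with n hn
  have hn' : (n : ℝ) ≠ 0 := by exact_mod_cast hn.ne'
  rw [sub_div, mul_div_assoc, div_self (pow_ne_zero _ hn')]
  ring

/-- Summing a sequence of growth `c n ^ k` over all pairs `(h, w)` with `h * w ≤ N` gives a zeta
value. -/
theorem tendsto_sum_hyperbola {a : ℕ → ℝ} {c : ℝ} {k : ℕ} (hk : 1 ≤ k)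
    (ha : Tendsto (fun n : ℕ => a n / (n : ℝ) ^ k) atTop (𝓝 c)) :
    Tendsto (fun N : ℕ => (∑ h ∈ Finset.Icc 1 N, ∑ w ∈ Finset.Icc 1 (N / h), a w) /
      (N : ℝ) ^ (k + 1)) atTop (𝓝 (c / (k + 1) * ∑' n : ℕ, 1 / (n : ℝ) ^ (k + 1))) := by
  let b : ℕ → ℝ := fun M => ∑ w ∈ Finset.Icc 1 M, a w
  have hb : Tendsto (fun M : ℕ => b M / (M : ℝ) ^ (k + 1)) atTop (𝓝 (c / (k + 1))) := by
    have h1 : Tendsto (fun n : ℕ => a (n + 1) / (n : ℝ) ^ k) atTop (𝓝 c) := by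
      have h2 : Tendsto (fun n : ℕ => (((n + 1 : ℕ) : ℝ) / n) ^ k) atTop (𝓝 (1 ^ k)) := by
        refine Tendsto.pow ?_ k
        have := (tendsto_one_div_atTop_nhds_zero_nat (𝕜 := ℝ)).const_add 1
        rw [add_zero] at this
        refine this.congr' ?_
        filter_upwards [eventually_gt_atTop 0] with n hn
        have hn' : (n : ℝ) ≠ 0 := by exact_mod_cast hn.ne'
        push_cast; field_simp
      have h3 := (ha.comp (tendsto_add_atTop_nat 1)).mul h2
      rw [one_pow, mul_one] at h3
      refine h3.congr fun n => ?_
      have : ((n + 1 : ℕ) : ℝ) ≠ 0 := by positivity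
      simp only [Function.comp_apply]
      rw [div_pow, div_mul_div_comm, mul_comm (a _), mul_div_mul_left _ _ (pow_ne_zero _ this)]
    refine (tendsto_sum_div_pow h1).congr fun n => ?_
    congr 1
    simp only [b]
    rw [Finset.range_eq_Ico, Finset.sum_Ico_add' a 0 n 1, zero_add]
    rfl
  have hbound : ∃ B : ℝ, ∀ M : ℕ, |b M| ≤ B * (M : ℝ) ^ (k + 1) := by
    obtain ⟨B, hB⟩ := hb.abs.bddAbove_range
    refine ⟨B, fun M => ?_⟩
    rcases Nat.eq_zero_or_pos M with rfl | hM
    · simp [b]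
    · have h1 : (0 : ℝ) < (M : ℝ) ^ (k + 1) := by positivity
      rw [← div_le_iff₀ h1]
      have := hB ⟨M, rfl⟩
      simpa [abs_div, abs_of_pos h1] using this
  obtain ⟨B, hB⟩ := hbound
  have hB0 : 0 ≤ B := by simpa using (abs_nonneg _).trans (hB 1)
  have hsumm : Summable fun h : ℕ => B * (1 / (h : ℝ) ^ (k + 1)) :=
    (Real.summable_one_div_nat_pow.2 (by omega)).mul_left B
  -- The `h`-th term tends to `c / (k + 1) / h ^ (k + 1)` and is dominated by `B / h ^ (k + 1)`.
  let F : ℕ → ℕ → ℝ := fun N h => if h = 0 then 0 else b (N / h) / (N : ℝ) ^ (k + 1)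
  have hF : Tendsto (fun N => ∑' h, F N h) atTop
      (𝓝 (∑' h : ℕ, c / (k + 1) * (1 / (h : ℝ) ^ (k + 1)))) := by
    refine tendsto_tsum_of_dominated_convergence hsumm (fun h => ?_) ?_
    · rcases Nat.eq_zero_or_pos h with rfl | hh
      · simp [F]
      · have h1 : Tendsto (fun N : ℕ => N / h) atTop atTop := Nat.tendsto_div_const_atTop hh.ne'
        have h2 := hb.comp h1
        have h3 : Tendsto (fun N : ℕ => (((N / h : ℕ) : ℝ) / N) ^ (k + 1)) atTop
            (𝓝 ((1 / (h : ℝ)) ^ (k + 1))) := by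
          refine Tendsto.pow ?_ _
          have h4 := (tendsto_nat_floor_mul_div_atTop (R := ℝ) (a := 1 / h) (by positivity)).comp
            tendsto_natCast_atTop_atTop
          refine h4.congr fun N => ?_
          simp only [Function.comp_apply]
          rw [one_div_mul_eq_div, Nat.floor_div_eq_div]
        refine (h2.mul h3).congr' ?_ |>.trans (by rw [one_div_pow])
        filter_upwards [eventually_ge_atTop h] with N hN
        have h5 : 0 < N / h := Nat.div_pos hN hh
        have h6 : ((N / h : ℕ) : ℝ) ^ (k + 1) ≠ 0 := by positivity
        simp only [Function.comp_apply, F, if_neg hh.ne']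
        rw [div_pow, div_mul_div_cancel₀ h6]
    · filter_upwards [eventually_gt_atTop 0] with N hN h
      rcases Nat.eq_zero_or_pos h with rfl | hh
      · simp [F]
      · have hN' : (0 : ℝ) < (N : ℝ) ^ (k + 1) := by positivity
        simp only [F, if_neg hh.ne', Real.norm_eq_abs]
        rw [abs_div, abs_of_pos hN', div_le_iff₀ hN']
        refine (hB _).trans ?_
        rw [mul_assoc]
        refine mul_le_mul_of_nonneg_left ?_ hB0
        rw [one_div_mul_eq_div, ← div_pow]
        exact pow_le_pow_left₀ (by positivity) Nat.cast_div_le _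
  rw [tsum_mul_left] at hF
  refine hF.congr fun N => ?_
  rw [tsum_eq_sum (s := Finset.Icc 1 N), Finset.sum_div]
  · refine Finset.sum_congr rfl fun h hh => ?_
    have : h ≠ 0 := by have := (Finset.mem_Icc.1 hh).1; omega
    simp only [F, if_neg this, b]
  · intro h hh
    rcases Nat.eq_zero_or_pos h with rfl | h0
    · simp [F]
    · have : N < h := by
        by_contra h'
        exact hh (Finset.mem_Icc.2 ⟨h0, by omega⟩)
      simp [F, b, Nat.div_eq_of_lt this]

/-! ### The contribution of one-cylinder surfaces in an arbitrary stratum -/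

open Asymptotics in
/-- The number of gluing classes grows like a power of the circumference. -/
theorem tendsto_card_gluingClass_div_pow {ι : Type*} [Fintype ι] [DecidableEq ι] [Nonempty ι]
    (m : ι → ℕ) :
    Tendsto (fun w : ℕ => (Nat.card (GluingClass m w) : ℝ) /
        (w : ℝ) ^ Fintype.card (ConeCorner m)) atTop
      (𝓝 ((∫ x in (0 : ℝ)..1, (permSegment (coneRotation m 1) x).det) / ∏ i, (m i + 1 : ℝ))) := by
  obtain ⟨i₀⟩ := ‹Nonempty ι›
  set K := Fintype.card (ConeCorner m)
  set I := ∫ x in (0 : ℝ)..1, (permSegment (coneRotation m 1) x).det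
  set Q := ∏ i, (m i + 1 : ℝ)
  have hK : 0 < K := Fintype.card_pos_iff.2 ⟨⟨i₀, 0⟩⟩
  have h1 : Tendsto (fun w : ℕ => (w.descFactorial K : ℝ) / (w : ℝ) ^ K) atTop (𝓝 1) := by
    refine (isEquivalent_iff_tendsto_one ?_).1 (isEquivalent_descFactorial K)
    filter_upwards [eventually_gt_atTop 0] with w hw
    have : (w : ℝ) ≠ 0 := by exact_mod_cast hw.ne'
    exact pow_ne_zero _ this
  have h2 : Tendsto (fun w : ℕ => (w.descFactorial K : ℝ) / (w : ℝ) ^ K * (I / Q)) atTop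
      (𝓝 (I / Q)) := by simpa using h1.mul_const (I / Q)
  have h3 : Tendsto (fun w : ℕ => (w.descFactorial K : ℝ) / (w : ℝ) ^ K * (I / Q) +
      (m i₀ + 1) * (1 / (w : ℝ))) atTop (𝓝 (I / Q)) := by
    simpa using h2.add ((tendsto_one_div_atTop_nhds_zero_nat (𝕜 := ℝ)).const_mul (m i₀ + 1 : ℝ))
  refine tendsto_of_tendsto_of_tendsto_of_le_of_le' h2 h3 ?_ ?_
  all_goals
    filter_upwards [eventually_gt_atTop 0] with w hw
    have : NeZero w := ⟨hw.ne'⟩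
    have hw' : (0 : ℝ) < w := by exact_mod_cast hw
    have hb := card_gluingClass_bounds (m := m) i₀ w
    have hQ : 0 < Q := Finset.prod_pos fun i _ => by positivity
  · rw [le_div_iff₀ (by positivity)]
    refine le_of_eq_of_le ?_ hb.1
    change _ = (w.descFactorial K : ℝ) * I / Q
    field_simp
  · rw [div_le_iff₀ (by positivity)]
    refine hb.2.trans_eq ?_
    obtain ⟨k, hk⟩ := Nat.exists_eq_succ_of_ne_zero hK.ne'
    change (w.descFactorial K : ℝ) * I / Q + _ * (w : ℝ) ^ (K - 1) = _
    rw [hk, Nat.succ_sub_one, pow_succ]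
    field_simp

/-- The contribution of one-cylinder surfaces to the Masur-Veech volume of a stratum. -/
theorem hasCylinderContribution_one {ι : Type} [Fintype ι] [DecidableEq ι] [Nonempty ι]
    (m : ι → ℕ) :
    HasCylinderContribution m 1 (2 *
      ((∫ x in (0 : ℝ)..1, (permSegment (coneRotation m 1) x).det) / ∏ i, (m i + 1 : ℝ)) *
      ∑' n : ℕ, 1 / (n : ℝ) ^ stratumDim m) := by
  have hK : 0 < Fintype.card (ConeCorner m) :=
    Fintype.card_pos_iff.2 ⟨⟨Classical.arbitrary ι, 0⟩⟩
  have hdim : stratumDim m = Fintype.card (ConeCorner m) + 1 := by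
    simp [stratumDim, ConeCorner, ZMod.card, Finset.sum_add_distrib]
  have h := (tendsto_sum_hyperbola hK (tendsto_card_gluingClass_div_pow m)).const_mul
    (2 * (stratumDim m : ℝ))
  rw [← hdim] at h
  have hd : (Fintype.card (ConeCorner m) : ℝ) + 1 ≠ 0 := by positivity
  have hd' : (stratumDim m : ℝ) = Fintype.card (ConeCorner m) + 1 := by rw [hdim]; push_cast; rfl
  refine (h.congr fun N => ?_).trans (le_of_eq ?_)
  · rw [ncard_squareTiledSurfaces_one]
    push_cast
    rfl
  · congr 1
    rw [hd']
    field_simp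

/-! ### The integrals for the minimal and the principal stratum -/

/-- The determinant for a single cycle of length `n + 1`. -/
theorem det_permSegment_addRight_one (n : ℕ) (x : ℝ) :
    (permSegment (Equiv.addRight (1 : Fin (n + 1))) x).det = x ^ (n + 1) - (x - 1) ^ (n + 1) := by
  rcases Nat.eq_zero_or_pos n with rfl | hn
  · have h : (Equiv.addRight (1 : Fin 1)) 0 = 0 := rfl
    rw [Matrix.det_fin_one]
    simp [permSegment_apply]
  have h1 (i j : Fin (n + 1)) : permSegment (Equiv.addRight (1 : Fin (n + 1))) x i j =
      x * (if i = j then 1 else 0) + (1 - x) * (if i + 1 = j then 1 else 0) :=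
    permSegment_apply _ _ _ _
  set M := permSegment (Equiv.addRight (1 : Fin (n + 1))) x
  -- Only the first and the last entry of the first column are non-zero.
  have hne : (0 : Fin (n + 1)) ≠ Fin.last n := by
    intro h; have := congrArg Fin.val h; simp at this; omega
  have hone : (1 : Fin (n + 1)).val = 1 := by
    rw [Fin.val_one']; exact Nat.mod_eq_of_lt (by omega)
  have h00 : M 0 0 = x := by
    have : (0 : Fin (n + 1)) + 1 ≠ 0 := by
      intro h; have := congrArg Fin.val h; rw [zero_add, hone] at this; simp at this
    rw [h1, if_pos rfl, if_neg this]; ring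
  have hl0 : M (Fin.last n) 0 = 1 - x := by
    rw [h1, if_neg hne.symm, if_pos (Fin.last_add_one n)]; ring
  have hi0 (i : Fin (n + 1)) (h0 : i ≠ 0) (hl : i ≠ Fin.last n) : M i 0 = 0 := by
    have : i + 1 ≠ 0 := by
      intro h
      apply hl
      rw [← Fin.last_add_one n] at h
      exact add_right_cancel h
    rw [h1, if_neg h0, if_neg this]; ring
  have hD0 : (M.submatrix (Fin.succAbove 0) Fin.succ).det = x ^ n := by
    rw [Matrix.det_of_isUpperTriangular]
    · have (a : Fin n) : a.succ + 1 ≠ a.succ := by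
        intro h
        have : (1 : Fin (n + 1)) = 0 := by simpa using h
        rw [this] at hone; simp at hone
      simp [h1, this]
    · intro a b hab
      have hab : b < a := hab
      have h2 : a.succ ≠ b.succ := fun h => hab.ne' (Fin.succ_inj.1 h)
      have h3 : a.succ + 1 ≠ b.succ := by
        intro h
        have h4 : (a.succ + 1).val = b.val + 1 := by rw [h]; rfl
        rw [Fin.val_add_one] at h4
        split_ifs at h4
        · have h5 : b.val < a.val := hab
          rw [Fin.val_succ] at h4
          omega
      simp [h1, h2, h3]
  have hDl : (M.submatrix (Fin.succAbove (Fin.last n)) Fin.succ).det = (1 - x) ^ n := by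
    rw [Matrix.det_of_isLowerTriangular]
    · have (a : Fin n) : a.castSucc ≠ a.succ := (Fin.castSucc_lt_succ).ne
      simp [h1, this]
    · intro a b hab
      have hab : a < b := hab
      have h2 : a.castSucc ≠ b.succ := by
        intro h
        have h4 : a.val = b.val + 1 := congrArg Fin.val h
        have : a.val < b.val := hab
        omega
      simp [h1, h2, hab.ne]
  rw [Matrix.det_succ_column_zero, Finset.sum_eq_add (0 : Fin (n + 1)) (Fin.last n) hne, hD0, hDl,
    h00, hl0]
  · have h3 : (x - 1) ^ (n + 1) = (-1) ^ (n + 1) * (1 - x) ^ (n + 1) := by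
      rw [← mul_pow]; ring
    rw [h3]
    simp only [Fin.val_zero, pow_zero, Fin.val_last, one_mul]
    ring
  · rintro i - ⟨h0, hl⟩
    rw [hi0 i h0 hl]; ring
  · simp
  · simp

/-- The determinant splits into the contributions of the zeros. -/
theorem det_permSegment_coneRotation {n : ℕ} (m : Fin n → ℕ) (x : ℝ) :
    (permSegment (coneRotation m 1) x).det = ∏ i, (x ^ (m i + 1) - (x - 1) ^ (m i + 1)) := by
  have h1 (k l : ConeCorner m) (h : k.1 ≠ l.1) : permSegment (coneRotation m 1) x k l = 0 := by
    have h2 : k ≠ l := fun h' => h (congrArg Sigma.fst h')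
    have h3 : coneRotation m 1 k ≠ l := fun h' =>
      h ((congrArg Sigma.fst (coneRotation_apply (m := m) 1 k)).symm.trans (congrArg Sigma.fst h'))
    rw [permSegment_apply, if_neg h2, if_neg h3]; ring
  have hbt : (permSegment (coneRotation m 1) x).BlockTriangular Sigma.fst :=
    fun k l hkl => h1 k l hkl.ne'
  rw [hbt.det_fintype]
  refine Finset.prod_congr rfl fun i _ => ?_
  rw [← det_permSegment_addRight_one]
  let e : {k : ConeCorner m // k.1 = i} ≃ Fin (m i + 1) := Equiv.sigmaSubtype i
  rw [← Matrix.det_submatrix_equiv_self e.symm]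
  congr 1
  ext a b
  have he (a : Fin (m i + 1)) : (e.symm a).1 = ⟨i, a⟩ := rfl
  rw [Matrix.submatrix_apply, Matrix.toSquareBlock_def, Matrix.of_apply, he, he, permSegment_apply,
    permSegment_apply, coneRotation_apply]
  have hinj (a b : Fin (m i + 1)) : (⟨i, a⟩ : ConeCorner m) = ⟨i, b⟩ ↔ a = b :=
    ⟨fun h => eq_of_heq (Sigma.mk.inj h).2, fun h => h ▸ rfl⟩
  exact congrArg₂ (fun s t : ℝ => x * s + (1 - x) * t)
    (if_congr (hinj a b) rfl rfl) (if_congr (hinj _ b) rfl rfl)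

theorem riemannZeta_natCast_re {d : ℕ} (hd : 1 < d) :
    (riemannZeta d).re = ∑' n : ℕ, 1 / (n : ℝ) ^ d := by
  rw [zeta_nat_eq_tsum_of_gt_one hd]
  have : (∑' n : ℕ, 1 / (n : ℂ) ^ d) = ((∑' n : ℕ, 1 / (n : ℝ) ^ d : ℝ) : ℂ) := by
    push_cast; rfl
  rw [this, Complex.ofReal_re]

/-- The integral is `∫ x in 0..1, x ^ (2 g - 1) - (x - 1) ^ (2 g - 1)`. -/
theorem integral_minimal (g : ℕ) (hg : 1 ≤ g) :
    ∫ x in (0 : ℝ)..1, (permSegment (coneRotation (fun _ : Fin 1 => 2 * g - 2) 1) x).det =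
      1 / g := by
  have h1 : 2 * g - 2 + 1 = 2 * (g - 1) + 1 := by omega
  obtain ⟨k, rfl⟩ : ∃ k, g = k + 1 := ⟨g - 1, by omega⟩
  simp only [det_permSegment_coneRotation, Finset.univ_unique, Finset.prod_singleton, h1,
    Nat.add_sub_cancel]
  have hc1 : Continuous fun x : ℝ => x ^ (2 * k + 1) := by fun_prop
  have hc2 : Continuous fun x : ℝ => (x - 1) ^ (2 * k + 1) := by fun_prop
  rw [intervalIntegral.integral_sub (hc1.intervalIntegrable _ _) (hc2.intervalIntegrable _ _)]
  rw [intervalIntegral.integral_comp_sub_right (fun x => x ^ (2 * k + 1)), integral_pow,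
    integral_pow]
  have : (2 * (k : ℝ) + 1 + 1) ≠ 0 := by positivity
  have h2 : (-1 : ℝ) ^ (2 * k + 1 + 1) = 1 := Even.neg_one_pow ⟨k + 1, by ring⟩
  rw [zero_sub, sub_self, h2]
  push_cast
  field_simp
  ring

/-- The integral is `∫ x in 0..1, (2 x - 1) ^ (2 g - 2)`. -/
theorem integral_principal (g : ℕ) (hg : 2 ≤ g) :
    ∫ x in (0 : ℝ)..1, (permSegment (coneRotation (fun _ : Fin (2 * g - 2) => 1) 1) x).det =
      1 / (2 * g - 1) := by
  obtain ⟨k, rfl⟩ : ∃ k, g = k + 1 := ⟨g - 1, by omega⟩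
  have h1 : 2 * (k + 1) - 2 = 2 * k := by omega
  rw [h1]
  have h2 (x : ℝ) : x ^ (1 + 1) - (x - 1) ^ (1 + 1) = 2 * x - 1 := by ring
  simp only [det_permSegment_coneRotation, h2, Finset.prod_const, Finset.card_univ,
    Fintype.card_fin]
  rw [intervalIntegral.integral_comp_mul_sub (fun x => x ^ (2 * k)) two_ne_zero, integral_pow]
  have h3 : (-1 : ℝ) ^ (2 * k + 1) = -1 := Odd.neg_one_pow ⟨k, rfl⟩
  have h4 : (2 * (k : ℝ) + 1) ≠ 0 := by positivity
  have h5 : 2 * ((k + 1 : ℕ) : ℝ) - 1 = 2 * k + 1 := by push_cast; ring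
  rw [h5, mul_zero, zero_sub, mul_one, smul_eq_mul, show (2 - 1 : ℝ) = 1 by norm_num, one_pow]
  push_cast
  rw [h3]
  field_simp
  ring

theorem corollary2p4 :
    (∀ g : ℕ, 2 ≤ g →
      HasCylinderContribution (fun _ : Fin (2 * g - 2) => 1) 1
        ((riemannZeta (4 * g - 3)).re / (4 * g - 2) * (4 / 2 ^ (2 * g - 2)))) ∧
    (∀ g : ℕ, 1 ≤ g →
      HasCylinderContribution (fun _ : Fin 1 => 2 * g - 2) 1
        ((riemannZeta (2 * g)).re / (2 * g) * (4 / (2 * g - 1)))) := by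
  refine ⟨fun g hg => ?_, fun g hg => ?_⟩
  · have : Nonempty (Fin (2 * g - 2)) := ⟨⟨0, by omega⟩⟩
    have h := hasCylinderContribution_one (fun _ : Fin (2 * g - 2) => 1)
    rw [integral_principal g hg] at h
    have hd : stratumDim (fun _ : Fin (2 * g - 2) => 1) = 4 * g - 3 := by
      simp [stratumDim]; omega
    rw [hd, ← riemannZeta_natCast_re (by omega), Nat.cast_sub (by omega)] at h
    push_cast at h
    convert h using 1
    have h1 : (2 * (g : ℝ) - 1) ≠ 0 := by
      have : (2 : ℝ) ≤ g := by exact_mod_cast hg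
      linarith
    have h2 : (4 * (g : ℝ) - 2) = 2 * (2 * g - 1) := by ring
    rw [h2, Finset.prod_const, Finset.card_univ, Fintype.card_fin]
    norm_num
    field_simp
    ring
  · have h := hasCylinderContribution_one (fun _ : Fin 1 => 2 * g - 2)
    rw [integral_minimal g hg] at h
    have hd : stratumDim (fun _ : Fin 1 => 2 * g - 2) = 2 * g := by
      simp [stratumDim]; omega
    rw [hd, ← riemannZeta_natCast_re (by omega)] at h
    push_cast [Nat.cast_sub (show 2 ≤ 2 * g by omega)] at h
    convert h using 1
    have h0 : (1 : ℝ) ≤ g := by exact_mod_cast hg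
    have h1 : (2 * (g : ℝ) - 1) ≠ 0 := by linarith
    have h2 : (2 * (g : ℝ) - 2 + 1) = 2 * g - 1 := by ring
    simp only [Finset.univ_unique, Finset.prod_singleton, h2]
    field_simp
    ring
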